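/- Let $\mathcal H$ be a complex Hilbert space of finite dimension $n+1\ge 1$, with Hermitian product $\langle\cdot|\cdot\rangle$ (conjugate linear in the first variable), let $\hbar>0$, and let $\mathcal S\subset\mathcal H$ be the unit sphere. Let $\mathcal P_{\mathcal H}=\mathcal S/U(1)=\mathbb P(\mathcal H)\cong\mathbb{CP}^n$ be the quantum phase space, with its standard complex manifold structure, and let $\pi(\psi)=[\psi]$ be the projection to rays. An observable is a self-adjoint operator $A$ on $\mathcal H$; observables are identified with $\mathfrak u(\mathcal H)$ by $A\mapsto iA$ and form a real Lie algebra under $[A,B]_-=\frac1i(AB-BA)$. Let $E=\mathcal P_{\mathcal H}\times\mathfrak u(\mathcal H)\to\mathcal P_{\mathcal H}$ be the bundle of observables, $\Gamma(E)$ its smooth sections, and let the Hamiltonian section $\sigma_A\in\Gamma(E)$ of $A$ be the constant section $A$. Put $H_A(\psi)=\langle\psi|A\psi\rangle$ and $\langle A\rangle([\psi])=\langle\psi|A\psi\rangle/\langle\psi|\psi\rangle$. Let $\{f,g\}=\frac1\hbar\sum_j\bigl(\frac{\partial f}{\partial z_j}\frac{\partial g}{\partial\bar z_j}-\frac{\partial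 g}{\partial z_j}\frac{\partial f}{\partial\bar z_j}\bigr)$ in the coordinates $z_j$ of an orthonormal basis of $\mathcal H$. The anchor $\rho:E\to T\mathcal P_{\mathcal H}$ is the fibrewise linear map given by the Schrödinger equation: for a unit vector $\psi$ in the ray $x$ (the one fixed in the construction), $\rho_x(A)=d\pi_\psi(\dot\psi)$ with $\dot\psi=i\hbar\{\psi,H_A\}$. Then: 1. $\pi:\mathcal S\to\mathcal P_{\mathcal H}$ is a smooth principal bundle for the group $U(1)$ of phases. The formula $$h_{[\psi]}(d\pi_\psi u,d\pi_\psi v)=\frac{\langle\psi|\psi\rangle\langle u|v\rangle-\langle u|\psi\rangle\langle\psi|v\rangle}{\langle\psi|\psi\rangle^2}\qquad(\psi\neq0,\ u,v\in\mathcal H)$$ determines a Hermitian product $h=g+i\omega$ on $T\mathcal P_{\mathcal H}$ which is a Kähler metric ($h$ is smooth and positive definite, $d\omega=0$). Every unitary operator $U$ of $\mathcal H$ induces the smooth map $[\psi]\mapsto[U\psi]$ of $\mathcal P_{\mathcal H}$, which preserves $h$. 2. For every observable $A$ and every $\psi\ne0$ one has $\rho_{[\psi]}(A)=d\pi_\psi(i\hbar\{\psi,H_A\})$,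 so that $\rho$ does not depend on the choice of representatives. The Schrödinger vector field $\rho(\sigma_A)$ is Hamiltonian: $\omega(\rho(\sigma_A),\cdot)=-\tfrac12\,d\langle A\rangle$. 3. The operators $e^{iAt}$ are unitary, $t\mapsto e^{iAt}\psi$ solves $\dot\psi=i\hbar\{\psi,H_A\}$ on $\mathcal H$, and for $\psi\neq0$ the curve $t\mapsto[e^{iAt}\psi]$ is an integral curve of $\rho(\sigma_A)$. 4. For $\psi\neq0$, $\rho(\sigma_A)$ vanishes at $[\psi]$ if and only if $\psi$ is an eigenvector of $A$. If $(\phi_k)$ is an orthonormal basis with $A\phi_k=a_k\phi_k$ and $\|\psi\|=1$, then the numbers $p_k=|\langle\phi_k|\psi\rangle|^2$ satisfy $\sum_kp_k=1$ and $\langle A\rangle([\psi])=\sum_ka_kp_k$. 5. There is exactly one bracket $[\![\cdot,\cdot]\!]$ on $\Gamma(E)$ with $[\![\sigma_A,\sigma_B]\!]=\sigma_{[A,B]_-}$ for all observables $A,B$ that makes $(E,[\![\cdot,\cdot]\!],\rho)$ a Lie algebroid over $\mathcal P_{\mathcal H}$: $\rho$ is a smooth bundle morphism, the bracket is $\mathbb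 R$-bilinear, antisymmetric and satisfies the Jacobi identity, $\rho[\![v,w]\!]=[\rho v,\rho w]$, and $[\![v,fw]\!]=\rho(v)(f)\,w+f[\![v,w]\!]$ for all $v,w\in\Gamma(E)$ and $f\in C^\infty(\mathcal P_{\mathcal H})$. -/

import Mathlib

open scoped LinearAlgebra.Projectivization Manifold ContDiff InnerProductSpace ComplexConjugate
open Module (finrank)

namespace QuantumPhase

noncomputable section

section Projective

variable {H : Type*} [NormedAddCommGroup H] [InnerProductSpace ℂ H]

/-- The quotient topology on the projective Hilbert space. -/
instance projTopology : TopologicalSpace (ℙ ℂ H) :=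
  TopologicalSpace.coinduced (Projectivization.mk' ℂ) inferInstance

theorem isQuotientMap_mk' :
    Topology.IsQuotientMap (Projectivization.mk' ℂ : {v : H // v ≠ 0} → ℙ ℂ H) :=
  ⟨⟨rfl⟩, Quotient.mk''_surjective⟩

theorem inner_rep_mk_ne_zero (φ v : H) (hv : v ≠ 0) :
    ⟪φ, (Projectivization.mk ℂ v hv).rep⟫_ℂ ≠ 0 ↔ ⟪φ, v⟫_ℂ ≠ 0 := by
  obtain ⟨a, ha⟩ := Projectivization.exists_smul_eq_mk_rep ℂ v hv
  rw [← ha, Units.smul_def, inner_smul_right]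
  simp

theorem isOpen_not_orthogonal (φ : H) : IsOpen {x : ℙ ℂ H | ⟪φ, x.rep⟫_ℂ ≠ 0} := by
  refine isQuotientMap_mk'.isOpen_preimage.mp ?_
  have : (Projectivization.mk' ℂ ⁻¹' {x : ℙ ℂ H | ⟪φ, x.rep⟫_ℂ ≠ 0}) =
      {v : {v : H // v ≠ 0} | ⟪φ, (v : H)⟫_ℂ ≠ 0} := by
    ext v
    exact inner_rep_mk_ne_zero _ v.1 v.2
  rw [this]
  exact isOpen_ne_fun (continuous_const.inner continuous_subtype_val) continuous_const

/-- The unit vector on the ray `x` obtained by normalising `x.rep`. -/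
def unitRep (x : ℙ ℂ H) : Metric.sphere (0 : H) 1 :=
  ⟨((‖x.rep‖ : ℂ)⁻¹) • x.rep, by
    have : ‖x.rep‖ ≠ 0 := norm_ne_zero_iff.mpr x.rep_nonzero
    rw [mem_sphere_zero_iff_norm, norm_smul, norm_inv, Complex.norm_real, norm_norm,
      inv_mul_cancel₀ this]⟩

variable {n : ℕ} [Fact (finrank ℂ H = n + 1)]

/-- A unitary identification of the orthogonal complement of a unit vector with `ℂⁿ`. -/
def frame (n : ℕ) [Fact (finrank ℂ H = n + 1)] (φ : Metric.sphere (0 : H) 1) :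
    (ℂ ∙ (φ : H))ᗮ ≃ₗᵢ[ℂ] EuclideanSpace ℂ (Fin n) :=
  (OrthonormalBasis.fromOrthogonalSpanSingleton n (ne_zero_of_mem_unit_sphere φ)).repr

/-- The affine coordinate `ψ ↦ ψ / ⟪φ, ψ⟫ - φ`, read in `φᗮ = ℂⁿ`. -/
def affineCoord (n : ℕ) [Fact (finrank ℂ H = n + 1)] (φ : Metric.sphere (0 : H) 1) (ψ : H) :
    EuclideanSpace ℂ (Fin n) :=
  frame n φ ((ℂ ∙ (φ : H))ᗮ.orthogonalProjectionOnto ((⟪(φ : H), ψ⟫_ℂ)⁻¹ • ψ))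

/-- The point `φ + w` of the affine hyperplane `{ψ | ⟪φ, ψ⟫ = 1}`. -/
def affineInv (n : ℕ) [Fact (finrank ℂ H = n + 1)] (φ : Metric.sphere (0 : H) 1)
    (w : EuclideanSpace ℂ (Fin n)) : H :=
  φ + ((frame n φ).symm w : H)

theorem inner_affineInv (φ : Metric.sphere (0 : H) 1) (w : EuclideanSpace ℂ (Fin n)) :
    ⟪(φ : H), affineInv n φ w⟫_ℂ = 1 := by
  have h1 : ⟪(φ : H), ((frame n φ).symm w : H)⟫_ℂ = 0 :=
    Submodule.mem_orthogonal_singleton_iff_inner_right.mp ((frame n φ).symm w).2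
  have h2 : ⟪(φ : H), (φ : H)⟫_ℂ = 1 := by
    rw [inner_self_eq_norm_sq_to_K, norm_eq_of_mem_sphere φ]; simp
  rw [affineInv, inner_add_right, h1, h2, add_zero]

theorem affineInv_ne_zero (φ : Metric.sphere (0 : H) 1) (w : EuclideanSpace ℂ (Fin n)) :
    affineInv n φ w ≠ 0 := by
  intro h
  have := inner_affineInv φ w
  rw [h, inner_zero_right] at this
  exact zero_ne_one this

theorem proj_self (φ : Metric.sphere (0 : H) 1) :
    (ℂ ∙ (φ : H))ᗮ.orthogonalProjectionOnto (φ : H) = 0 :=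
  Submodule.orthogonalProjectionOnto_orthogonal_apply_eq_zero
    (Submodule.mem_span_singleton_self _)

theorem affineCoord_affineInv (φ : Metric.sphere (0 : H) 1) (w : EuclideanSpace ℂ (Fin n)) :
    affineCoord n φ (affineInv n φ w) = w := by
  rw [affineCoord, inner_affineInv, inv_one, one_smul, affineInv, map_add, proj_self, zero_add,
    Submodule.orthogonalProjectionOnto_mem_subspace_eq_self, LinearIsometryEquiv.apply_symm_apply]

theorem affineInv_affineCoord (φ : Metric.sphere (0 : H) 1) {ψ : H} (h : ⟪(φ : H), ψ⟫_ℂ ≠ 0) :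
    affineInv n φ (affineCoord n φ ψ) = (⟪(φ : H), ψ⟫_ℂ)⁻¹ • ψ := by
  have hmem : (⟪(φ : H), ψ⟫_ℂ)⁻¹ • ψ - φ ∈ (ℂ ∙ (φ : H))ᗮ := by
    rw [Submodule.mem_orthogonal_singleton_iff_inner_right, inner_sub_right, inner_smul_right,
      inv_mul_cancel₀ h, inner_self_eq_norm_sq_to_K, norm_eq_of_mem_sphere φ]
    simp
  have h1 : (ℂ ∙ (φ : H))ᗮ.orthogonalProjectionOnto ((⟪(φ : H), ψ⟫_ℂ)⁻¹ • ψ) =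
      ⟨(⟪(φ : H), ψ⟫_ℂ)⁻¹ • ψ - φ, hmem⟩ := by
    have := Submodule.orthogonalProjectionOnto_mem_subspace_eq_self
      (K := (ℂ ∙ (φ : H))ᗮ) ⟨(⟪(φ : H), ψ⟫_ℂ)⁻¹ • ψ - φ, hmem⟩
    have h2 := map_sub (ℂ ∙ (φ : H))ᗮ.orthogonalProjectionOnto ((⟪(φ : H), ψ⟫_ℂ)⁻¹ • ψ) φ
    rw [proj_self, sub_zero] at h2
    exact h2.symm.trans this
  rw [affineInv, affineCoord, LinearIsometryEquiv.symm_apply_apply, h1]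
  simp

theorem affineCoord_smul (φ : Metric.sphere (0 : H) 1) (ψ : H) {c : ℂ} (hc : c ≠ 0) :
    affineCoord n φ (c • ψ) = affineCoord n φ ψ := by
  rw [affineCoord, affineCoord, inner_smul_right, mul_inv, smul_smul, mul_right_comm,
    inv_mul_cancel₀ hc, one_mul]

theorem contDiff_affineInv (φ : Metric.sphere (0 : H) 1) : ContDiff ℂ ω (affineInv n φ) :=
  contDiff_const.add
    ((ℂ ∙ (φ : H))ᗮ.subtypeL.contDiff.comp (frame n φ).symm.toContinuousLinearEquiv.contDiff)

theorem contDiffOn_affineCoord (φ : Metric.sphere (0 : H) 1) :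
    ContDiffOn ℂ ω (affineCoord n φ) {ψ | ⟪(φ : H), ψ⟫_ℂ ≠ 0} := by
  refine (frame n φ).toContinuousLinearEquiv.contDiff.comp_contDiffOn
    ((ContinuousLinearMap.contDiff _).comp_contDiffOn ?_)
  exact ((innerSL ℂ (φ : H)).contDiff.contDiffOn.inv fun _ h => h).smul contDiffOn_id

/-- The affine chart of the projective space centred at the ray of the unit vector `φ`, defined
on the rays that are not orthogonal to `φ`. -/
def affineChart (n : ℕ) [Fact (finrank ℂ H = n + 1)] (φ : Metric.sphere (0 : H) 1) :
    OpenPartialHomeomorph (ℙ ℂ H) (EuclideanSpace ℂ (Fin n)) where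
  toFun := Projectivization.lift (fun ψ => affineCoord n φ ψ) (by
    rintro ⟨a, ha⟩ ⟨b, hb⟩ t (h : a = t • b)
    have ht : t ≠ 0 := by rintro rfl; exact ha (by simpa using h)
    simp only [h]
    exact affineCoord_smul φ b ht)
  invFun w := Projectivization.mk ℂ (affineInv n φ w) (affineInv_ne_zero φ w)
  source := {x | ⟪(φ : H), x.rep⟫_ℂ ≠ 0}
  target := Set.univ
  map_source' _ _ := Set.mem_univ _
  map_target' w _ := by
    show ⟪(φ : H), (Projectivization.mk ℂ (affineInv n φ w) (affineInv_ne_zero φ w)).rep⟫_ℂ ≠ 0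
    rw [inner_rep_mk_ne_zero, inner_affineInv]
    exact one_ne_zero
  left_inv' x := by
    induction x using Projectivization.ind with
    | h v hv =>
      intro hx
      have hx' : ⟪(φ : H), v⟫_ℂ ≠ 0 := (inner_rep_mk_ne_zero _ v hv).mp hx
      refine (Projectivization.mk_eq_mk_iff' ℂ _ _ _ _).mpr ⟨(⟪(φ : H), v⟫_ℂ)⁻¹, ?_⟩
      exact (affineInv_affineCoord φ hx').symm
  right_inv' w _ := affineCoord_affineInv φ w
  open_source := isOpen_not_orthogonal _
  open_target := isOpen_univ
  continuousOn_toFun := by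
    refine (isQuotientMap_mk'.continuousOn_isOpen_iff (isOpen_not_orthogonal _)).mpr ?_
    exact (contDiffOn_affineCoord φ).continuousOn.comp continuous_subtype_val.continuousOn
      fun v hv => (inner_rep_mk_ne_zero _ v.1 v.2).mp hv
  continuousOn_invFun := by
    refine Continuous.continuousOn ?_
    exact isQuotientMap_mk'.continuous.comp
      ((contDiff_affineInv φ).continuous.subtype_mk (affineInv_ne_zero φ))

/-- The smooth (indeed complex analytic) structure of the projective Hilbert space. -/
instance projChartedSpace : ChartedSpace (EuclideanSpace ℂ (Fin n)) (ℙ ℂ H) where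
  atlas := Set.range (affineChart n)
  chartAt x := affineChart n (unitRep x)
  mem_chart_source x := by
    show ⟪((‖x.rep‖ : ℂ)⁻¹) • x.rep, x.rep⟫_ℂ ≠ 0
    have : ‖x.rep‖ ≠ 0 := norm_ne_zero_iff.mpr x.rep_nonzero
    rw [inner_smul_left, inner_self_eq_norm_sq_to_K]
    simpa using x.rep_nonzero
  chart_mem_atlas x := ⟨unitRep x, rfl⟩

theorem contDiffOn_transition (φ φ' : Metric.sphere (0 : H) 1) :
    ContDiffOn ℂ ω ((affineChart n φ).symm ≫ₕ affineChart n φ')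
      ((affineChart n φ).symm ≫ₕ affineChart n φ').source := by
  refine (contDiffOn_affineCoord φ').comp (contDiff_affineInv φ).contDiffOn ?_
  intro w hw
  have : ⟪(φ' : H),
      (Projectivization.mk ℂ (affineInv n φ w) (affineInv_ne_zero φ w)).rep⟫_ℂ ≠ 0 := hw.2
  exact (inner_rep_mk_ne_zero _ _ _).mp this

instance projComplexManifold :
    IsManifold (modelWithCornersSelf ℂ (EuclideanSpace ℂ (Fin n))) ω (ℙ ℂ H) := by
  refine isManifold_of_contDiffOn _ _ _ ?_
  rintro _ _ ⟨φ, rfl⟩ ⟨φ', rfl⟩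
  simpa using contDiffOn_transition φ φ'

instance projRealManifold :
    IsManifold (𝓘(ℝ, EuclideanSpace ℂ (Fin n))) ω (ℙ ℂ H) := by
  refine isManifold_of_contDiffOn _ _ _ ?_
  rintro _ _ ⟨φ, rfl⟩ ⟨φ', rfl⟩
  simpa using (contDiffOn_transition φ φ').restrict_scalars ℝ

end Projective

section Sphere

variable {H : Type*} [NormedAddCommGroup H] [InnerProductSpace ℂ H] {n : ℕ}

theorem fact_finrank_real (h : finrank ℂ H = n + 1) : Fact (finrank ℝ H = (2 * n + 1) + 1) :=
  ⟨by rw [finrank_real_of_complex, h]; ring⟩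

/-- The unit sphere of a complex Hilbert space of dimension `n + 1` as the real manifold `S²ⁿ⁺¹`,
with Mathlib's stereographic charts for the real inner product `Re ⟪·, ·⟫`. -/
instance sphereChartedSpace [h : Fact (finrank ℂ H = n + 1)] :
    ChartedSpace (EuclideanSpace ℝ (Fin (2 * n + 1))) (Metric.sphere (0 : H) 1) :=
  letI : InnerProductSpace ℝ H := InnerProductSpace.complexToReal
  haveI : Fact (finrank ℝ H = (2 * n + 1) + 1) := fact_finrank_real h.out
  EuclideanSpace.instChartedSpaceSphere

instance sphereIsManifold [h : Fact (finrank ℂ H = n + 1)] :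
    IsManifold (𝓡 (2 * n + 1)) ω (Metric.sphere (0 : H) 1) :=
  letI : InnerProductSpace ℝ H := InnerProductSpace.complexToReal
  haveI : Fact (finrank ℝ H = (2 * n + 1) + 1) := fact_finrank_real h.out
  EuclideanSpace.instIsManifoldSphere

/-- The phase action `(z, ψ) ↦ z ψ` of `U(1)` on the unit sphere. -/
def phaseAct (z : Circle) (ψ : Metric.sphere (0 : H) 1) : Metric.sphere (0 : H) 1 :=
  ⟨(z : ℂ) • (ψ : H), by
    rw [mem_sphere_zero_iff_norm, norm_smul, Circle.norm_coe, norm_eq_of_mem_sphere ψ, one_mul]⟩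

/-- The projection of a unit vector onto its ray. -/
def phaseProj (ψ : Metric.sphere (0 : H) 1) : ℙ ℂ H :=
  Projectivization.mk ℂ (ψ : H) (ne_zero_of_mem_unit_sphere ψ)

end Sphere

section General

/-- `π : P → B` is a smooth principal bundle for the action `act` of the Lie group `G`: near every
point of `B` there are a smooth section `s` of `π` and a smooth map `τ` to `G` such that
`p ↦ (π p, τ p)` and `(b, g) ↦ act g (s b)` are mutually inverse. -/
structure IsPrincipalBundle
    {EG : Type*} [NormedAddCommGroup EG] [NormedSpace ℝ EG] {HG : Type*} [TopologicalSpace HG]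
    (IG : ModelWithCorners ℝ EG HG)
    {EP : Type*} [NormedAddCommGroup EP] [NormedSpace ℝ EP] {HP : Type*} [TopologicalSpace HP]
    (IP : ModelWithCorners ℝ EP HP)
    {EB : Type*} [NormedAddCommGroup EB] [NormedSpace ℝ EB] {HB : Type*} [TopologicalSpace HB]
    (IB : ModelWithCorners ℝ EB HB)
    {G : Type*} [Group G] [TopologicalSpace G] [ChartedSpace HG G] [LieGroup IG ∞ G]
    {P : Type*} [TopologicalSpace P] [ChartedSpace HP P]
    {B : Type*} [TopologicalSpace B] [ChartedSpace HB B]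
    (act : G → P → P) (π : P → B) : Prop where
  contMDiff_proj : ContMDiff IP IB ∞ π
  surjective_proj : Function.Surjective π
  contMDiff_act : ContMDiff (IG.prod IP) IP ∞ (fun q : G × P => act q.1 q.2)
  one_act : ∀ p, act 1 p = p
  mul_act : ∀ g g' p, act (g * g') p = act g (act g' p)
  proj_act : ∀ g p, π (act g p) = π p
  locally_trivial : ∀ b : B, ∃ U : Set B, IsOpen U ∧ b ∈ U ∧ ∃ (s : B → P) (τ : P → G),
    ContMDiffOn IB IP ∞ s U ∧ ContMDiffOn IP IG ∞ τ (π ⁻¹' U) ∧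
    (∀ x ∈ U, π (s x) = x) ∧ (∀ x ∈ U, ∀ g, τ (act g (s x)) = g) ∧
    ∀ p, π p ∈ U → act (τ p) (s (π p)) = p

/-- The derivative of the real function `f` at `x` in the direction of the tangent vector `v`. -/
def dirDeriv {E : Type*} [NormedAddCommGroup E] [NormedSpace ℝ E] {K : Type*} [TopologicalSpace K]
    (I : ModelWithCorners ℝ E K) {M : Type*} [TopologicalSpace M] [ChartedSpace K M]
    (f : M → ℝ) (x : M) (v : TangentSpace I x) : ℝ :=
  mfderiv I (modelWithCornersSelf ℝ ℝ) f x v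

/-- The data of a bracket on the smooth sections of the real vector bundle `V → M` and of a
fibrewise linear map `anchor : V → TM` form a Lie algebroid: the anchor is a smooth bundle
morphism, the bracket is a real Lie bracket, the anchor takes it to the Lie bracket of vector
fields, and the Leibniz rule `⟦v, f w⟧ = ρ(v)(f) w + f ⟦v, w⟧` holds. -/
structure IsLieAlgebroid
    {E : Type*} [NormedAddCommGroup E] [NormedSpace ℝ E] {K : Type*} [TopologicalSpace K]
    (I : ModelWithCorners ℝ E K)
    {M : Type*} [TopologicalSpace M] [ChartedSpace K M] [IsManifold I ∞ M]
    (F : Type*) [NormedAddCommGroup F] [NormedSpace ℝ F]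
    (V : M → Type*) [TopologicalSpace (Bundle.TotalSpace F V)] [∀ x, TopologicalSpace (V x)]
    [∀ x, AddCommGroup (V x)] [∀ x, Module ℝ (V x)] [FiberBundle F V] [VectorBundle ℝ F V]
    [ContMDiffVectorBundle ∞ F V I]
    (bracket : Cₛ^∞⟮I; F, V⟯ → Cₛ^∞⟮I; F, V⟯ → Cₛ^∞⟮I; F, V⟯)
    (anchor : ∀ x : M, V x →ₗ[ℝ] TangentSpace I x) : Prop where
  anchor_smooth : ContMDiff (I.prod (modelWithCornersSelf ℝ F)) I.tangent ∞
    (fun p : Bundle.TotalSpace F V => (⟨p.1, anchor p.1 p.2⟩ : TangentBundle I M))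
  bracket_add : ∀ u v w, bracket u (v + w) = bracket u v + bracket u w
  bracket_smul : ∀ (r : ℝ) u v, bracket u (r • v) = r • bracket u v
  bracket_antisymm : ∀ u v, bracket u v = - bracket v u
  jacobi : ∀ u v w,
    bracket u (bracket v w) + bracket v (bracket w u) + bracket w (bracket u v) = 0
  anchor_bracket : ∀ u v x, anchor x (bracket u v x) =
    VectorField.mlieBracket I (fun y => anchor y (u y)) (fun y => anchor y (v y)) x
  leibniz : ∀ (u v w : Cₛ^∞⟮I; F, V⟯) (f : C^∞⟮I, M; ℝ⟯), (∀ x, w x = f x • v x) →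
    ∀ x, bracket u w x = dirDeriv I f x (anchor x (u x)) • v x + f x • bracket u v x

/-- Multiplication by `i` on the real tangent spaces of a complex manifold. -/
def complexStructure {E : Type*} [NormedAddCommGroup E] [NormedSpace ℂ E] {M : Type*}
    [TopologicalSpace M] [ChartedSpace E M] {x : M}
    (u : TangentSpace (modelWithCornersSelf ℝ E) x) : TangentSpace (modelWithCornersSelf ℝ E) x :=
  (Complex.I • (show E from u) : E)

/-- The expression of a family `h` of forms on the tangent spaces in the chart `e`, evaluated on
the coordinate vectors `u` and `v`. -/
def chartForm {E : Type*} [NormedAddCommGroup E] [NormedSpace ℂ E] {M : Type*}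
    [TopologicalSpace M] [ChartedSpace E M]
    (h : ∀ x : M, TangentSpace (modelWithCornersSelf ℝ E) x →
      TangentSpace (modelWithCornersSelf ℝ E) x → ℂ)
    (e : OpenPartialHomeomorph M E) (u v : E) (w : E) : ℂ :=
  h (e.symm w)
    (mfderiv (modelWithCornersSelf ℝ E) (modelWithCornersSelf ℝ E) e.symm w u)
    (mfderiv (modelWithCornersSelf ℝ E) (modelWithCornersSelf ℝ E) e.symm w v)

/-- `h = g + i ω` is a Kähler metric on the complex manifold `M`: a smooth positive definite
Hermitian form on the tangent spaces (conjugate linear in the first variable) whose imaginary part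
`ω` is closed, `dω = 0` being written out in the charts. -/
structure IsKahlerMetric {E : Type*} [NormedAddCommGroup E] [NormedSpace ℂ E] {M : Type*}
    [TopologicalSpace M] [ChartedSpace E M] [IsManifold (modelWithCornersSelf ℂ E) ω M]
    (h : ∀ x : M, TangentSpace (modelWithCornersSelf ℝ E) x →
      TangentSpace (modelWithCornersSelf ℝ E) x → ℂ) : Prop where
  add_right : ∀ x u v w, h x u (v + w) = h x u v + h x u w
  smul_right : ∀ x u v (r : ℝ), h x u (r • v) = r * h x u v
  complexStructure_right : ∀ x u v, h x u (complexStructure v) = Complex.I * h x u v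
  conj_symm : ∀ x u v, conj (h x u v) = h x v u
  pos_def : ∀ x u, u ≠ 0 → 0 < (h x u u).re
  smooth : ∀ e ∈ atlas E M, ∀ u v : E, ContDiffOn ℝ ∞ (chartForm h e u v) e.target
  closed : ∀ e ∈ atlas E M, ∀ w ∈ e.target, ∀ u v t : E,
    fderiv ℝ (fun y => (chartForm h e u v y).im) w t +
      fderiv ℝ (fun y => (chartForm h e v t y).im) w u +
      fderiv ℝ (fun y => (chartForm h e t u y).im) w v = 0

end General

section Schrodinger

variable {H : Type*} [NormedAddCommGroup H] [InnerProductSpace ℂ H] [CompleteSpace H]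

/-- An observable: a bounded self-adjoint operator. -/
abbrev Observable (H : Type*) [NormedAddCommGroup H] [InnerProductSpace ℂ H] [CompleteSpace H] :=
  selfAdjoint (H →L[ℂ] H)

/-- The bundle `ℙ(H) × 𝔲(H)` over the projective space, where `𝔲(H)` is identified with the real
vector space of observables by `A ↦ i A`. -/
abbrev ObservableBundle (H : Type*) [NormedAddCommGroup H] [InnerProductSpace ℂ H]
    [CompleteSpace H] : ℙ ℂ H → Type _ :=
  Bundle.Trivial (ℙ ℂ H) (Observable H)

instance observableBundleAddCommGroup (x : ℙ ℂ H) : AddCommGroup (ObservableBundle H x) :=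
  inferInstanceAs (AddCommGroup (Observable H))

instance observableBundleModule (x : ℙ ℂ H) : Module ℝ (ObservableBundle H x) :=
  inferInstanceAs (Module ℝ (Observable H))

/-- The Lie bracket `(1/i) (A B - B A)` of observables. -/
def observableBracket (A B : Observable H) : Observable H :=
  ⟨(-Complex.I) • ((A : H →L[ℂ] H) * B - B * A), by
    have hA : star (A : H →L[ℂ] H) = A := A.2
    have hB : star (B : H →L[ℂ] H) = B := B.2
    rw [selfAdjoint.mem_iff, star_smul, star_sub, star_mul, star_mul, hA, hB, ← neg_sub, smul_neg,
      ← neg_smul]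
    simp⟩

/-- The Hamiltonian function `ψ ↦ ⟨ψ | A ψ⟩` of an observable. -/
def hamiltonian (A : Observable H) (ψ : H) : ℂ := ⟪ψ, (A : H →L[ℂ] H) ψ⟫_ℂ

/-- The expectation value `⟨ψ | A ψ⟩ / ⟨ψ | ψ⟩` as a function on the projective space. -/
def expectation (A : Observable H) (x : ℙ ℂ H) : ℝ :=
  (hamiltonian A x.rep).re / ‖x.rep‖ ^ 2

/-- The holomorphic derivative `∂f (v) = (Df (v) - i Df (i v)) / 2`. -/
def delHol {W : Type*} [NormedAddCommGroup W] [NormedSpace ℂ W] (f : H → W) (ψ v : H) : W :=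
  (1 / 2 : ℂ) • (fderiv ℝ f ψ v - Complex.I • fderiv ℝ f ψ (Complex.I • v))

/-- The antiholomorphic derivative `(Df (v) + i Df (i v)) / 2`. -/
def delBar {W : Type*} [NormedAddCommGroup W] [NormedSpace ℂ W] (f : H → W) (ψ v : H) : W :=
  (1 / 2 : ℂ) • (fderiv ℝ f ψ v + Complex.I • fderiv ℝ f ψ (Complex.I • v))

/-- The Poisson bracket
`{f, g} = ħ⁻¹ ∑ⱼ (∂f/∂zⱼ ∂g/∂z̄ⱼ - ∂g/∂zⱼ ∂f/∂z̄ⱼ)` in the coordinates `zⱼ` of an orthonormal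
basis of the Hilbert space, so that `{zⱼ, z̄ₖ} = δⱼₖ / ħ`; the first argument may take values in a
complex vector space. -/
def poissonBracket [FiniteDimensional ℂ H] {W : Type*} [NormedAddCommGroup W] [NormedSpace ℂ W]
    (ħ : ℝ) (f : H → W) (g : H → ℂ) (ψ : H) : W :=
  (ħ : ℂ)⁻¹ • ∑ j, (delBar g ψ (stdOrthonormalBasis ℂ H j) • delHol f ψ (stdOrthonormalBasis ℂ H j)
    - delHol g ψ (stdOrthonormalBasis ℂ H j) • delBar f ψ (stdOrthonormalBasis ℂ H j))

/-- The Schrödinger vector `i ħ {ψ, H_A}`. -/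
def schrodingerVector [FiniteDimensional ℂ H] (ħ : ℝ) (A : Observable H) (ψ : H) : H :=
  (Complex.I * ħ) • poissonBracket ħ id (hamiltonian A) ψ

theorem fderiv_hamiltonian (A : Observable H) (ψ v : H) :
    fderiv ℝ (hamiltonian A) ψ v = 2 * (⟪(A : H →L[ℂ] H) ψ, v⟫_ℂ).re := by
  have hd : HasFDerivAt (𝕜 := ℝ) (fun y : H => (A : H →L[ℂ] H) y)
      ((A : H →L[ℂ] H).restrictScalars ℝ) ψ :=
    ((A : H →L[ℂ] H).restrictScalars ℝ).hasFDerivAt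
  have h := (hasFDerivAt_id (𝕜 := ℝ) ψ).inner ℂ hd
  have e : fderiv ℝ (hamiltonian A) ψ v =
      ⟪ψ, (A : H →L[ℂ] H) v⟫_ℂ + ⟪v, (A : H →L[ℂ] H) ψ⟫_ℂ := by
    have h' : HasFDerivAt (hamiltonian A) _ ψ := h
    rw [h'.fderiv]
    simp [fderivInnerCLM_apply]
  have hs : ⟪ψ, (A : H →L[ℂ] H) v⟫_ℂ = ⟪(A : H →L[ℂ] H) ψ, v⟫_ℂ :=
    ((ContinuousLinearMap.isSelfAdjoint_iff_isSymmetric.mp A.2) ψ v).symm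
  rw [e, hs, ← inner_conj_symm v, Complex.add_conj]
  push_cast
  ring

theorem schrodingerVector_eq [FiniteDimensional ℂ H] (ħ : ℝ) (A : Observable H) (ψ : H) :
    schrodingerVector ħ A ψ = (Complex.I * ħ * (ħ : ℂ)⁻¹) • (A : H →L[ℂ] H) ψ := by
  have h1 : ∀ v, delHol (id : H → H) ψ v = v := fun v => by
    rw [delHol, fderiv_id, ContinuousLinearMap.id_apply, ContinuousLinearMap.id_apply, smul_smul,
      Complex.I_mul_I, neg_one_smul, sub_neg_eq_add, ← two_smul ℂ v, smul_smul]
    norm_num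
  have h2 : ∀ v, delBar (id : H → H) ψ v = 0 := fun v => by
    rw [delBar, fderiv_id, ContinuousLinearMap.id_apply, ContinuousLinearMap.id_apply, smul_smul,
      Complex.I_mul_I, neg_one_smul, add_neg_cancel, smul_zero]
  have h3 : ∀ v, delBar (hamiltonian A) ψ v = ⟪v, (A : H →L[ℂ] H) ψ⟫_ℂ := fun v => by
    rw [delBar, fderiv_hamiltonian, fderiv_hamiltonian, inner_smul_right,
      ← inner_conj_symm v]
    generalize ⟪(A : H →L[ℂ] H) ψ, v⟫_ℂ = z
    apply Complex.ext <;> simp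
  rw [schrodingerVector, poissonBracket, smul_smul]
  congr 1
  conv_rhs => rw [← (stdOrthonormalBasis ℂ H).sum_repr' ((A : H →L[ℂ] H) ψ)]
  refine Finset.sum_congr rfl fun j _ => ?_
  rw [h1, h2, h3, smul_zero, sub_zero]

/-- The unitary evolution `e^{itA}`. -/
def unitaryFlow (A : Observable H) (t : ℝ) : H →L[ℂ] H :=
  NormedSpace.exp ((t * Complex.I : ℂ) • (A : H →L[ℂ] H))

open Classical in
/-- The ray of a nonzero vector. The value at `0` is irrelevant. -/
def ray [Nontrivial H] (ψ : H) : ℙ ℂ H :=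
  if h : ψ = 0 then Classical.arbitrary _ else Projectivization.mk ℂ ψ h

/-- The map induced by a unitary operator on the projective space. -/
def unitaryAct [Nontrivial H] (U : unitary (H →L[ℂ] H)) (x : ℙ ℂ H) : ℙ ℂ H :=
  ray ((U : H →L[ℂ] H) x.rep)

/-- The differential at `ψ ≠ 0` of the projection `ψ ↦ [ψ]`. -/
def rayDeriv [Nontrivial H] (n : ℕ) [Fact (finrank ℂ H = n + 1)] (ψ : H) :
    H →L[ℝ] TangentSpace (𝓘(ℝ, EuclideanSpace ℂ (Fin n))) (ray ψ) :=
  mfderiv (modelWithCornersSelf ℝ H) (𝓘(ℝ, EuclideanSpace ℂ (Fin n))) ray ψ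

/-- The anchor: the fibre of the bundle of observables over `x = [ψ]`, with `ψ` a unit vector, is
mapped to the tangent space at `x` by sending `A` to the velocity of the ray `[ψ]` under the
Schrödinger equation `ψ̇ = i ħ {ψ, H_A}`. -/
def schrodingerAnchor [FiniteDimensional ℂ H] [Nontrivial H] (n : ℕ)
    [Fact (finrank ℂ H = n + 1)] (ħ : ℝ) (x : ℙ ℂ H) :
    ObservableBundle H x →ₗ[ℝ]
      TangentSpace (𝓘(ℝ, EuclideanSpace ℂ (Fin n))) x where
  toFun A := rayDeriv n (unitRep x : H) (schrodingerVector ħ A (unitRep x : H))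
  map_add' A B := by
    have : schrodingerVector ħ (A + B : Observable H) (unitRep x : H) =
        schrodingerVector ħ (A : Observable H) (unitRep x : H) +
        schrodingerVector ħ (B : Observable H) (unitRep x : H) := by
      simp only [schrodingerVector_eq, ← smul_add]
      rfl
    exact (congrArg (rayDeriv n (unitRep x : H)) this).trans (map_add _ _ _)
  map_smul' r A := by
    have : schrodingerVector ħ (r • A : Observable H) (unitRep x : H) =
        r • schrodingerVector ħ (A : Observable H) (unitRep x : H) := by
      simp only [schrodingerVector_eq]
      rw [smul_comm r]
      rfl
    exact (congrArg (rayDeriv n (unitRep x : H)) this).trans (map_smul _ _ _)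

/-- The smooth sections of the bundle of observables. -/
abbrev ObservableSection (n : ℕ) (H : Type*) [NormedAddCommGroup H] [InnerProductSpace ℂ H]
    [CompleteSpace H] [Fact (finrank ℂ H = n + 1)] :=
  Cₛ^∞⟮𝓘(ℝ, EuclideanSpace ℂ (Fin n)); Observable H, ObservableBundle H⟯

/-- The Hamiltonian section `σ_A`: the section of the bundle of observables with constant
value `A`. -/
def hamiltonianSection (n : ℕ) [Fact (finrank ℂ H = n + 1)] (A : Observable H) :
    ObservableSection n H where
  toFun _ := A
  contMDiff_toFun := by
    intro x
    rw [Bundle.contMDiffAt_section]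
    exact contMDiffAt_const

/-- The horizontal lift to the Hilbert space of a tangent vector at the ray `x`: the vector
orthogonal to `unitRep x` with the given coordinates in the affine chart centred at `x`. -/
def horizontalLift (n : ℕ) [Fact (finrank ℂ H = n + 1)] {x : ℙ ℂ H}
    (u : TangentSpace (𝓘(ℝ, EuclideanSpace ℂ (Fin n))) x) : H :=
  ((frame n (unitRep x)).symm (show EuclideanSpace ℂ (Fin n) from u) : H)

/-- The Hermitian product `g + i ω` that the Hilbert space induces on the projective space: its
real part is the Fubini-Study metric. -/
def fubiniStudy (n : ℕ) [Fact (finrank ℂ H = n + 1)] (x : ℙ ℂ H)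
    (u v : TangentSpace (𝓘(ℝ, EuclideanSpace ℂ (Fin n))) x) : ℂ :=
  ⟪horizontalLift n u, horizontalLift n v⟫_ℂ

end Schrodinger

end

end QuantumPhase

open QuantumPhase

/-!
Every object on the projective space is controlled by its lift along the ray map `ψ ↦ [ψ]` on the
nonzero vectors. In the affine chart centred at a unit vector `φ` this map is
`ψ ↦ ψ / ⟪φ, ψ⟫ - φ`, so it is a submersion with kernel `ℂ ψ` at `ψ`, a function of the rays is
smooth as soon as its lift is (`contMDiff_of_comp_ray`), and the Fubini-Study product of the images
of `u` and `v` is the product of their components orthogonal to `ψ`, divided by `‖ψ‖²`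
(`fubiniStudy_rayDeriv`). In a chart the metric is an explicit rational expression, from which
smoothness and closedness of its imaginary part are read off (`isKahlerMetric_fubiniStudy`). Unitary
operators preserve the inner product, hence the metric.

Local trivialisations of the bundle of phases come from the sections `w ↦ (φ + w) / ‖φ + w‖` of the
affine charts, with the phase of `⟪φ, ψ⟫` as the group coordinate
(`isPrincipalBundle_phaseProj`).

The Schrödinger vector at `ψ` is `i A ψ`. It is complex homogeneous in `ψ`, so the anchor is
the push-forward of a linear vector field along the ray map (`schrodingerAnchor_ray`). The
Hamiltonian property, the integral curves and the zeros of the anchor follow by a computation in the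
Hilbert space.

For the algebroid, the bracket of two sections `a`, `b`, read as functions of the vectors, is
`[a, b] + Db (X_a) - Da (X_b)` with `X_a ψ = i a(ψ) ψ`. This is the action algebroid of a linear
action of a Lie algebra: its axioms hold for maps on a normed space (`lieBracket_actionField`,
`actionBracket_jacobi`, `actionBracket_smul`) and descend to the projective space by homogeneity
(`projBracket_ray`); the vector fields `X_a` are related by the affine coordinate to the
corresponding fields on the projective space, so their Lie brackets are related as well
(`anchor_projBracket`). Uniqueness holds because the constant sections of a basis of the observables
form a frame, so that the Leibniz rule and antisymmetry reduce any bracket to its values on constant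
sections (`IsLieAlgebroid.bracket_ext`).
-/

namespace QuantumPhase

noncomputable section

/-! ### Rays, affine charts and the derivative of the ray map -/

section Ray

variable {H : Type*} [NormedAddCommGroup H] [InnerProductSpace ℂ H] {n : ℕ}

theorem unitRep_ne_zero (x : ℙ ℂ H) : (unitRep x : H) ≠ 0 := ne_zero_of_mem_unit_sphere _

theorem inner_self_unit (φ : Metric.sphere (0 : H) 1) : ⟪(φ : H), (φ : H)⟫_ℂ = 1 := by
  rw [inner_self_eq_norm_sq_to_K, norm_eq_of_mem_sphere φ]; simp

theorem isOpen_inner_ne_zero (φ : H) : IsOpen {ψ : H | ⟪φ, ψ⟫_ℂ ≠ 0} :=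
  isOpen_ne_fun (continuous_const.inner continuous_id) continuous_const

theorem ne_zero_of_inner_ne_zero {φ ψ : H} (h : ⟪φ, ψ⟫_ℂ ≠ 0) : ψ ≠ 0 := by
  rintro rfl
  exact h (inner_zero_right _)

section

variable [Fact (finrank ℂ H = n + 1)]

theorem affineChart_mem_maximalAtlas (φ : Metric.sphere (0 : H) 1) :
    affineChart n φ ∈ IsManifold.maximalAtlas 𝓘(ℝ, EuclideanSpace ℂ (Fin n)) ∞ (ℙ ℂ H) :=
  IsManifold.subset_maximalAtlas ⟨φ, rfl⟩

theorem contDiffOn_real_affineCoord (φ : Metric.sphere (0 : H) 1) :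
    ContDiffOn ℝ ∞ (affineCoord n φ) {ψ | ⟪(φ : H), ψ⟫_ℂ ≠ 0} :=
  ((contDiffOn_affineCoord φ).restrict_scalars ℝ).of_le le_top

theorem contDiff_real_affineInv (φ : Metric.sphere (0 : H) 1) :
    ContDiff ℝ ∞ (affineInv n φ) :=
  ((contDiff_affineInv φ).restrict_scalars ℝ).of_le le_top

/-- The inverse of an affine chart is globally smooth, since the chart is onto `ℂⁿ`. -/
theorem contMDiff_affineChart_symm (φ : Metric.sphere (0 : H) 1) :
    ContMDiff 𝓘(ℝ, EuclideanSpace ℂ (Fin n)) 𝓘(ℝ, EuclideanSpace ℂ (Fin n)) ∞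
      (affineChart n φ).symm := by
  have := contMDiffOn_symm_of_mem_maximalAtlas (affineChart_mem_maximalAtlas (n := n) φ)
  exact contMDiffOn_univ.mp this

/-- The derivative of the affine coordinate by the quotient rule. -/
theorem fderiv_affineCoord (φ : Metric.sphere (0 : H) 1) {ψ : H} (h : ⟪(φ : H), ψ⟫_ℂ ≠ 0)
    (u : H) : fderiv ℝ (affineCoord n φ) ψ u =
      frame n φ ((ℂ ∙ (φ : H))ᗮ.orthogonalProjectionOnto
        ((⟪(φ : H), ψ⟫_ℂ)⁻¹ • u - ((⟪(φ : H), ψ⟫_ℂ ^ 2)⁻¹ * ⟪(φ : H), u⟫_ℂ) • ψ)) := by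
  have h1 : HasFDerivAt (fun ψ : H => (⟪(φ : H), ψ⟫_ℂ)⁻¹ • ψ) _ ψ :=
    ((hasDerivAt_inv h).comp_hasFDerivAt ψ ((innerSL ℂ (φ : H)).hasFDerivAt)).smul
      (hasFDerivAt_id (𝕜 := ℂ) ψ)
  have h2 := ((frame n φ).toContinuousLinearEquiv.toContinuousLinearMap.comp
    (ℂ ∙ (φ : H))ᗮ.orthogonalProjectionOnto).hasFDerivAt.comp ψ h1
  have h3 : HasFDerivAt (affineCoord n φ) _ ψ := h2.restrictScalars ℝ
  rw [h3.fderiv]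
  simp [sub_eq_add_neg]

theorem horizontalLift_injective (x : ℙ ℂ H) :
    Function.Injective (horizontalLift n : TangentSpace 𝓘(ℝ, EuclideanSpace ℂ (Fin n)) x → H) :=
  Subtype.val_injective.comp (frame n (unitRep x)).symm.injective

theorem inner_unitRep_horizontalLift {x : ℙ ℂ H}
    (u : TangentSpace 𝓘(ℝ, EuclideanSpace ℂ (Fin n)) x) :
    ⟪(unitRep x : H), horizontalLift n u⟫_ℂ = 0 :=
  Submodule.mem_orthogonal_singleton_iff_inner_right.mp
    ((frame n (unitRep x)).symm (show EuclideanSpace ℂ (Fin n) from u)).2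

end

variable [Nontrivial H]

theorem ray_eq_mk {ψ : H} (h : ψ ≠ 0) : ray ψ = Projectivization.mk ℂ ψ h := dif_neg h

theorem ray_rep (x : ℙ ℂ H) : ray x.rep = x := by
  rw [ray_eq_mk x.rep_nonzero, Projectivization.mk_rep]

theorem ray_smul {ψ : H} {c : ℂ} (hc : c ≠ 0) : ray (c • ψ) = ray ψ := by
  by_cases h : ψ = 0
  · rw [h, smul_zero]
  · rw [ray_eq_mk h, ray_eq_mk (smul_ne_zero hc h)]
    exact (Projectivization.mk_eq_mk_iff' ℂ _ _ _ _).mpr ⟨c, rfl⟩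

theorem ray_unitRep (x : ℙ ℂ H) : ray (unitRep x : H) = x := by
  have h : ((‖x.rep‖ : ℂ)⁻¹) ≠ 0 := by simpa using x.rep_nonzero
  exact (ray_smul h).trans (ray_rep x)

/-- The unit vector chosen on the ray of `ψ` differs from `ψ` by a nonzero scalar. -/
theorem exists_eq_smul_unitRep {ψ : H} (h : ψ ≠ 0) :
    ∃ c : ℂ, c ≠ 0 ∧ ψ = c • (unitRep (ray ψ) : H) := by
  have h1 := ray_unitRep (ray ψ)
  rw [ray_eq_mk (unitRep_ne_zero _), ray_eq_mk h,
    Projectivization.mk_eq_mk_iff' ℂ] at h1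
  obtain ⟨a, ha⟩ := h1
  have ha0 : a ≠ 0 := by
    rintro rfl
    rw [zero_smul] at ha
    exact unitRep_ne_zero _ ha.symm
  refine ⟨a⁻¹, inv_ne_zero ha0, ?_⟩
  have hr : ray ψ = Projectivization.mk ℂ ψ h := ray_eq_mk h
  rw [hr, ← ha, smul_smul, inv_mul_cancel₀ ha0, one_smul]

theorem inner_unitRep_ray_ne_zero {ψ : H} (h : ψ ≠ 0) :
    ⟪(unitRep (ray ψ) : H), ψ⟫_ℂ ≠ 0 := by
  obtain ⟨c, hc, e⟩ := exists_eq_smul_unitRep h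
  have : ⟪(unitRep (ray ψ) : H), c • (unitRep (ray ψ) : H)⟫_ℂ = c := by
    rw [inner_smul_right, inner_self_unit, mul_one]
  rw [← e] at this
  rwa [this]

variable [Fact (finrank ℂ H = n + 1)]

theorem mem_affineChart_source_ray (φ : Metric.sphere (0 : H) 1) {ψ : H} (h : ψ ≠ 0) :
    ray ψ ∈ (affineChart n φ).source ↔ ⟪(φ : H), ψ⟫_ℂ ≠ 0 := by
  rw [ray_eq_mk h]
  exact inner_rep_mk_ne_zero _ ψ h

theorem affineChart_ray (φ : Metric.sphere (0 : H) 1) {ψ : H} (h : ψ ≠ 0) :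
    affineChart n φ (ray ψ) = affineCoord n φ ψ := by
  rw [ray_eq_mk h]; rfl

theorem coe_affineChart_symm (φ : Metric.sphere (0 : H) 1) :
    ((affineChart n φ).symm : EuclideanSpace ℂ (Fin n) → ℙ ℂ H) = ray ∘ affineInv n φ := by
  funext w
  exact (ray_eq_mk (affineInv_ne_zero φ w)).symm

variable (n) in
theorem contMDiffAt_ray {ψ : H} (h : ψ ≠ 0) :
    ContMDiffAt 𝓘(ℝ, H) 𝓘(ℝ, EuclideanSpace ℂ (Fin n)) ∞ ray ψ := by
  set φ := unitRep (ray ψ)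
  have ho := (isOpen_inner_ne_zero (φ : H)).mem_nhds (inner_unitRep_ray_ne_zero h)
  have h1 : ContMDiffAt 𝓘(ℝ, H) 𝓘(ℝ, EuclideanSpace ℂ (Fin n)) ∞
      ((affineChart n φ).symm ∘ affineCoord n φ) ψ :=
    (contMDiff_affineChart_symm φ).contMDiffAt.comp ψ
      ((contDiffOn_real_affineCoord φ).contDiffAt ho).contMDiffAt
  refine h1.congr_of_eventuallyEq ?_
  filter_upwards [ho] with y hy
  have hy0 := ne_zero_of_inner_ne_zero hy
  rw [Function.comp_apply, ← affineChart_ray φ hy0, OpenPartialHomeomorph.left_inv]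
  exact (mem_affineChart_source_ray φ hy0).mpr hy

theorem mdifferentiableAt_ray {ψ : H} (h : ψ ≠ 0) :
    MDifferentiableAt 𝓘(ℝ, H) 𝓘(ℝ, EuclideanSpace ℂ (Fin n)) ray ψ :=
  (contMDiffAt_ray n h).mdifferentiableAt (by simp)

/-- The derivative of the ray map at `ψ`, read in the preferred chart at the ray of `ψ`. -/
theorem rayDeriv_apply {ψ : H} (h : ψ ≠ 0) (u : H) :
    rayDeriv n ψ u = (fderiv ℝ (affineCoord n (unitRep (ray ψ))) ψ u :
      EuclideanSpace ℂ (Fin n)) := by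
  have e : rayDeriv n ψ = fderiv ℝ (affineChart n (unitRep (ray ψ)) ∘ ray) ψ := by
    rw [rayDeriv, (mdifferentiableAt_ray h).mfderiv]
    simp only [writtenInExtChartAt, extChartAt, mfld_simps, fderivWithin_univ]
    rfl
  have e2 : (affineChart n (unitRep (ray ψ)) ∘ ray) =ᶠ[nhds ψ]
      affineCoord n (unitRep (ray ψ)) := by
    filter_upwards [isOpen_ne.mem_nhds h] with y hy
    exact affineChart_ray _ hy
  rw [e, e2.fderiv_eq]
  rfl

/-- The horizontal lift of the image of `u` is the component of `u` orthogonal to `ψ`, rescaled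
by the factor that carries `ψ` to the unit vector chosen on its ray. -/
theorem horizontalLift_rayDeriv {ψ : H} (h : ψ ≠ 0) (u : H) :
    horizontalLift n (rayDeriv n ψ u) = (⟪(unitRep (ray ψ) : H), ψ⟫_ℂ)⁻¹ •
      (u - (⟪ψ, u⟫_ℂ / ⟪ψ, ψ⟫_ℂ) • ψ) := by
  rw [rayDeriv_apply h]
  have hi := inner_unitRep_ray_ne_zero h
  obtain ⟨c, hc, e⟩ := exists_eq_smul_unitRep h
  rw [fderiv_affineCoord _ hi]
  refine (congrArg Subtype.val ((frame n (unitRep (ray ψ))).symm_apply_apply _)).trans ?_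
  set φ := unitRep (ray ψ)
  have hψ : (ℂ ∙ (φ : H))ᗮ.orthogonalProjectionOnto ψ = 0 := by
    rw [e, map_smul, proj_self, smul_zero]
  have hm : u - ⟪(φ : H), u⟫_ℂ • (φ : H) ∈ (ℂ ∙ (φ : H))ᗮ := by
    rw [Submodule.mem_orthogonal_singleton_iff_inner_right, inner_sub_right, inner_smul_right,
      inner_self_unit]
    simp
  have hu : (ℂ ∙ (φ : H))ᗮ.orthogonalProjectionOnto u = ⟨_, hm⟩ := by
    have h1 := Submodule.orthogonalProjectionOnto_mem_subspace_eq_self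
      (K := (ℂ ∙ (φ : H))ᗮ) ⟨_, hm⟩
    rw [map_sub, map_smul, proj_self, smul_zero, sub_zero] at h1
    exact h1
  rw [map_sub, map_smul, map_smul, hψ, smul_zero, sub_zero, hu]
  simp only [Submodule.coe_smul]
  congr 2
  have hs : ∀ c : ℂ, c ≠ 0 → ⟪(φ : H), u⟫_ℂ • (φ : H) =
      (⟪c • (φ : H), u⟫_ℂ / ⟪c • (φ : H), c • (φ : H)⟫_ℂ) • c • (φ : H) := fun c hc => by
    have hc' : conj c ≠ 0 := by simpa using hc
    rw [inner_smul_left, inner_smul_left, inner_smul_right, inner_self_unit, smul_smul]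
    congr 1
    field_simp
  rw [hs c hc, ← e]

/-- `‖ψ‖² = |⟪φ, ψ⟫|²` for the unit vector `φ` chosen on the ray of `ψ`. -/
theorem inner_self_eq_conj_mul_inner_unitRep {ψ : H} (h : ψ ≠ 0) :
    ⟪ψ, ψ⟫_ℂ = conj ⟪(unitRep (ray ψ) : H), ψ⟫_ℂ * ⟪(unitRep (ray ψ) : H), ψ⟫_ℂ := by
  obtain ⟨c, hc, e⟩ := exists_eq_smul_unitRep h
  have hs : ∀ c : ℂ, ∀ φ : Metric.sphere (0 : H) 1, ⟪c • (φ : H), c • (φ : H)⟫_ℂ =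
      conj ⟪(φ : H), c • (φ : H)⟫_ℂ * ⟪(φ : H), c • (φ : H)⟫_ℂ := fun c φ => by
    rw [inner_smul_left, inner_smul_right, inner_self_unit, mul_one]
  have := hs c (unitRep (ray ψ))
  rwa [← e] at this

/-- The Fubini-Study product of two images is the product of the components orthogonal to `ψ`; the
two rescaling factors of the horizontal lifts combine to `‖ψ‖⁻²`. -/
theorem fubiniStudy_rayDeriv {ψ : H} (h : ψ ≠ 0) (u v : H) :
    fubiniStudy n (ray ψ) (rayDeriv n ψ u) (rayDeriv n ψ v) =
      (⟪ψ, ψ⟫_ℂ * ⟪u, v⟫_ℂ - ⟪u, ψ⟫_ℂ * ⟪ψ, v⟫_ℂ) / ⟪ψ, ψ⟫_ℂ ^ 2 := by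
  have h0 : ⟪ψ, ψ⟫_ℂ ≠ 0 := by simpa using h
  have hc := inner_unitRep_ray_ne_zero h
  have hc' : conj ⟪(unitRep (ray ψ) : H), ψ⟫_ℂ ≠ 0 := (map_ne_zero _).mpr hc
  have e := inner_self_eq_conj_mul_inner_unitRep h
  rw [fubiniStudy, horizontalLift_rayDeriv h, horizontalLift_rayDeriv h]
  simp only [inner_smul_left, inner_smul_right, inner_sub_left, inner_sub_right, map_inv₀,
    map_div₀, inner_conj_symm ψ ψ, inner_conj_symm u ψ]
  generalize ⟪(unitRep (ray ψ) : H), ψ⟫_ℂ = c at *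
  generalize ⟪ψ, ψ⟫_ℂ = s at *
  subst e
  field_simp
  ring

theorem rayDeriv_surjective {ψ : H} (h : ψ ≠ 0) : Function.Surjective (rayDeriv n ψ) := by
  intro u
  have hc := inner_unitRep_ray_ne_zero h
  refine ⟨⟪(unitRep (ray ψ) : H), ψ⟫_ℂ • horizontalLift n u, horizontalLift_injective _ ?_⟩
  obtain ⟨c, -, e⟩ := exists_eq_smul_unitRep h
  have h0 : ⟪ψ, horizontalLift n u⟫_ℂ = 0 := by
    refine (congrArg (fun y => ⟪y, horizontalLift n u⟫_ℂ) e).trans ?_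
    rw [inner_smul_left, inner_unitRep_horizontalLift, mul_zero]
  rw [horizontalLift_rayDeriv h, inner_smul_right, h0, mul_zero, zero_div, zero_smul, sub_zero,
    smul_smul, inv_mul_cancel₀ hc, one_smul]

theorem rayDeriv_eq_zero_iff {ψ : H} (h : ψ ≠ 0) (u : H) :
    rayDeriv n ψ u = 0 ↔ ∃ c : ℂ, u = c • ψ := by
  have hc := inner_unitRep_ray_ne_zero h
  have h0 : ⟪ψ, ψ⟫_ℂ ≠ 0 := by simpa using h
  have hz : horizontalLift n (0 : TangentSpace 𝓘(ℝ, EuclideanSpace ℂ (Fin n)) (ray ψ)) = 0 := by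
    exact congrArg Subtype.val (map_zero (frame n (unitRep (ray ψ))).symm)
  rw [← (horizontalLift_injective (ray ψ)).eq_iff, hz, horizontalLift_rayDeriv h,
    smul_eq_zero_iff_right (inv_ne_zero hc), sub_eq_zero]
  constructor
  · exact fun e => ⟨_, e⟩
  · rintro ⟨c, rfl⟩
    rw [inner_smul_right, mul_div_assoc, div_self h0, mul_one]

/-- The ray map is constant along complex scaling, hence so is its derivative when the direction is
scaled as well. The equality is one of coordinates in the preferred chart at the common ray. -/
theorem rayDeriv_smul {ψ : H} {c : ℂ} (h : ψ ≠ 0) (hc : c ≠ 0) (u : H) :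
    (rayDeriv n (c • ψ) (c • u) : EuclideanSpace ℂ (Fin n)) = rayDeriv n ψ u := by
  have h1 := inner_unitRep_ray_ne_zero h
  have hr : ray (c • ψ) = ray ψ := ray_smul hc
  rw [rayDeriv_apply (smul_ne_zero hc h), rayDeriv_apply h, hr,
    fderiv_affineCoord _ h1, fderiv_affineCoord _
      (by rw [inner_smul_right]; exact mul_ne_zero hc h1)]
  simp only [inner_smul_right, smul_smul]
  congr 4 <;> field_simp

end Ray

/-! ### Maps on the projective space and their lifts -/

section Descent

variable {H : Type*} [NormedAddCommGroup H] [InnerProductSpace ℂ H] {n : ℕ}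
  [Fact (finrank ℂ H = n + 1)]

/-- The Hermitian product only depends on the base point and on the coordinates of the two
tangent vectors in the preferred chart. -/
theorem fubiniStudy_congr {x y : ℙ ℂ H} (h : x = y) (u v : EuclideanSpace ℂ (Fin n)) :
    fubiniStudy n x u v = fubiniStudy n y u v := by
  subst h; rfl

variable [Nontrivial H]

/-- Rays are locally the classes of smoothly varying vectors, so that a map on the projective
space is smooth as soon as its lift to the nonzero vectors is. -/
theorem contMDiff_of_comp_ray {E' : Type*} [NormedAddCommGroup E'] [NormedSpace ℝ E']
    {K : Type*} [TopologicalSpace K] {J : ModelWithCorners ℝ E' K} {N : Type*}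
    [TopologicalSpace N] [ChartedSpace K N] {g : ℙ ℂ H → N}
    (hg : ∀ ψ : H, ψ ≠ 0 → ContMDiffAt 𝓘(ℝ, H) J ∞ (fun y => g (ray y)) ψ) :
    ContMDiff 𝓘(ℝ, EuclideanSpace ℂ (Fin n)) J ∞ g := by
  intro x
  set φ := unitRep x
  have hx : x ∈ (affineChart n φ).source := mem_chart_source (EuclideanSpace ℂ (Fin n)) x
  have h1 : ContMDiffAt 𝓘(ℝ, EuclideanSpace ℂ (Fin n)) 𝓘(ℝ, EuclideanSpace ℂ (Fin n)) ∞
      (affineChart n φ) x :=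
    contMDiffAt_of_mem_maximalAtlas (affineChart_mem_maximalAtlas φ) hx
  have h2 : ContMDiffAt 𝓘(ℝ, EuclideanSpace ℂ (Fin n)) 𝓘(ℝ, H) ∞
      (affineInv n φ ∘ affineChart n φ) x :=
    (contDiff_real_affineInv φ).contMDiff.contMDiffAt.comp x h1
  refine ((hg _ (affineInv_ne_zero φ _)).comp x h2).congr_of_eventuallyEq ?_
  filter_upwards [(affineChart n φ).open_source.mem_nhds hx] with y hy
  have := congrFun (coe_affineChart_symm (n := n) φ) (affineChart n φ y)
  rw [Function.comp_apply] at this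
  simp only [Function.comp_apply]
  rw [← this, (affineChart n φ).left_inv hy]

theorem exists_ray_eq (x : ℙ ℂ H) : ∃ ψ : H, ψ ≠ 0 ∧ ray ψ = x :=
  ⟨unitRep x, unitRep_ne_zero x, ray_unitRep x⟩

theorem mfderiv_comp_ray {E' : Type*} [NormedAddCommGroup E'] [NormedSpace ℝ E']
    {K : Type*} [TopologicalSpace K] {J : ModelWithCorners ℝ E' K} {N : Type*}
    [TopologicalSpace N] [ChartedSpace K N] {g : ℙ ℂ H → N}
    {ψ : H} (h : ψ ≠ 0)
    (hg : MDifferentiableAt 𝓘(ℝ, EuclideanSpace ℂ (Fin n)) J g (ray ψ)) (u : H) :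
    mfderiv 𝓘(ℝ, EuclideanSpace ℂ (Fin n)) J g (ray ψ) (rayDeriv n ψ u) =
      mfderiv 𝓘(ℝ, H) J (g ∘ ray) ψ u := by
  rw [mfderiv_comp ψ hg (mdifferentiableAt_ray h)]
  rfl

end Descent

/-! ### The action of the unitary group -/

section UnitaryAction

variable {H : Type*} [NormedAddCommGroup H] [InnerProductSpace ℂ H] [CompleteSpace H]
  {n : ℕ} (U : unitary (H →L[ℂ] H))

theorem unitary_inner_map_map (u v : H) :
    ⟪(U : H →L[ℂ] H) u, (U : H →L[ℂ] H) v⟫_ℂ = ⟪u, v⟫_ℂ := by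
  rw [← ContinuousLinearMap.adjoint_inner_left, ← ContinuousLinearMap.star_eq_adjoint,
    ← mul_apply_eq_comp, Unitary.coe_star_mul_self]
  rfl

theorem unitary_apply_ne_zero {ψ : H} (h : ψ ≠ 0) : (U : H →L[ℂ] H) ψ ≠ 0 := by
  rw [← inner_self_ne_zero (𝕜 := ℂ), unitary_inner_map_map]
  exact inner_self_ne_zero.mpr h

variable [Nontrivial H]

theorem unitaryAct_ray {ψ : H} (h : ψ ≠ 0) :
    unitaryAct U (ray ψ) = ray ((U : H →L[ℂ] H) ψ) := by
  have hr := ray_rep (ray ψ)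
  rw [ray_eq_mk (ray ψ).rep_nonzero, ray_eq_mk h, Projectivization.mk_eq_mk_iff' ℂ] at hr
  obtain ⟨a, ha⟩ := hr
  rw [ray_eq_mk h] at *
  have ha0 : a ≠ 0 := by
    rintro rfl
    rw [zero_smul] at ha
    exact (Projectivization.mk ℂ ψ h).rep_nonzero ha.symm
  rw [unitaryAct, ← ha, map_smul, ray_smul ha0]

variable [Fact (finrank ℂ H = n + 1)]

theorem contMDiffAt_ray_unitary {ψ : H} (h : ψ ≠ 0) :
    ContMDiffAt 𝓘(ℝ, H) 𝓘(ℝ, EuclideanSpace ℂ (Fin n)) ∞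
      (fun y => ray ((U : H →L[ℂ] H) y)) ψ :=
  (contMDiffAt_ray n (unitary_apply_ne_zero U h)).comp ψ
    ((U : H →L[ℂ] H).restrictScalars ℝ).contMDiff.contMDiffAt

theorem unitaryAct_ray_eventuallyEq {ψ : H} (h : ψ ≠ 0) :
    (fun y => unitaryAct U (ray y)) =ᶠ[nhds ψ] fun y => ray ((U : H →L[ℂ] H) y) := by
  filter_upwards [isOpen_ne.mem_nhds h] with y hy using unitaryAct_ray U hy

variable (n) in
theorem contMDiff_unitaryAct :
    ContMDiff 𝓘(ℝ, EuclideanSpace ℂ (Fin n)) 𝓘(ℝ, EuclideanSpace ℂ (Fin n)) ∞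
      (unitaryAct U : ℙ ℂ H → ℙ ℂ H) :=
  contMDiff_of_comp_ray fun _ h =>
    (contMDiffAt_ray_unitary U h).congr_of_eventuallyEq (unitaryAct_ray_eventuallyEq U h)

theorem mfderiv_unitaryAct_rayDeriv {ψ : H} (h : ψ ≠ 0) (u : H) :
    (mfderiv 𝓘(ℝ, EuclideanSpace ℂ (Fin n)) 𝓘(ℝ, EuclideanSpace ℂ (Fin n))
      (unitaryAct U) (ray ψ) (rayDeriv n ψ u) : EuclideanSpace ℂ (Fin n)) =
      rayDeriv n ((U : H →L[ℂ] H) ψ) ((U : H →L[ℂ] H) u) := by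
  have h1 := (contMDiff_unitaryAct n U).mdifferentiable (by simp) (ray ψ)
  refine (mfderiv_comp_ray h h1 u).trans ?_
  have h2 : HasMFDerivAt 𝓘(ℝ, H) 𝓘(ℝ, H) (fun y => (U : H →L[ℂ] H) y) ψ
      ((U : H →L[ℂ] H).restrictScalars ℝ) :=
    ((U : H →L[ℂ] H).restrictScalars ℝ).hasMFDerivAt
  have h3 := (mdifferentiableAt_ray (n := n) (unitary_apply_ne_zero U h)).hasMFDerivAt.comp ψ h2
  have h4 := (h3.congr_of_eventuallyEq (unitaryAct_ray_eventuallyEq U h)).mfderiv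
  exact congrArg (fun L : H →L[ℝ] EuclideanSpace ℂ (Fin n) => L u) h4

/-- Every tangent vector is the image of a vector of the Hilbert space, where the invariance is that
of the inner product. -/
theorem fubiniStudy_mfderiv_unitaryAct (x : ℙ ℂ H)
    (u v : TangentSpace 𝓘(ℝ, EuclideanSpace ℂ (Fin n)) x) :
    fubiniStudy n (unitaryAct U x)
        (mfderiv 𝓘(ℝ, EuclideanSpace ℂ (Fin n)) 𝓘(ℝ, EuclideanSpace ℂ (Fin n))
          (unitaryAct U) x u)
        (mfderiv 𝓘(ℝ, EuclideanSpace ℂ (Fin n)) 𝓘(ℝ, EuclideanSpace ℂ (Fin n))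
          (unitaryAct U) x v) =
      fubiniStudy n x u v := by
  obtain ⟨ψ, h, rfl⟩ := exists_ray_eq x
  obtain ⟨u, rfl⟩ := rayDeriv_surjective h u
  obtain ⟨v, rfl⟩ := rayDeriv_surjective h v
  refine (fubiniStudy_congr (unitaryAct_ray U h) _ _).trans ?_
  refine (congrArg₂ (fubiniStudy n (ray ((U : H →L[ℂ] H) ψ)))
    (mfderiv_unitaryAct_rayDeriv U h u) (mfderiv_unitaryAct_rayDeriv U h v)).trans ?_
  rw [fubiniStudy_rayDeriv (unitary_apply_ne_zero U h), fubiniStudy_rayDeriv h]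
  simp only [unitary_inner_map_map]

end UnitaryAction

/-! ### The Kähler structure -/

section Kahler

variable {H : Type*} [NormedAddCommGroup H] [InnerProductSpace ℂ H] [Nontrivial H] {n : ℕ}
  [Fact (finrank ℂ H = n + 1)]

/-- The inverse of the affine chart is the ray map after the affine map `w ↦ φ + w`. -/
theorem mfderiv_affineChart_symm (φ : Metric.sphere (0 : H) 1)
    (w u : EuclideanSpace ℂ (Fin n)) :
    (mfderiv 𝓘(ℝ, EuclideanSpace ℂ (Fin n)) 𝓘(ℝ, EuclideanSpace ℂ (Fin n))
      (affineChart n φ).symm w u : EuclideanSpace ℂ (Fin n)) =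
      rayDeriv n (affineInv n φ w) ((frame n φ).symm u : H) := by
  have h1 : HasFDerivAt (𝕜 := ℝ) (affineInv n φ)
      (((ℂ ∙ (φ : H))ᗮ.subtypeL.comp
        (frame n φ).symm.toContinuousLinearEquiv.toContinuousLinearMap).restrictScalars ℝ) w :=
    (((ℂ ∙ (φ : H))ᗮ.subtypeL.comp
        (frame n φ).symm.toContinuousLinearEquiv.toContinuousLinearMap).restrictScalars
          ℝ).hasFDerivAt.const_add (φ : H)
  have h2 := (mdifferentiableAt_ray (n := n) (affineInv_ne_zero φ w)).hasMFDerivAt.comp w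
    h1.hasMFDerivAt
  rw [coe_affineChart_symm, h2.mfderiv]
  rfl

/-- The Fubini-Study form in an affine chart. -/
theorem chartForm_fubiniStudy (φ : Metric.sphere (0 : H) 1) (u v w : EuclideanSpace ℂ (Fin n)) :
    chartForm (M := ℙ ℂ H) (fubiniStudy n) (affineChart n φ) u v w =
      ((1 + ‖w‖ ^ 2 : ℝ) * ⟪u, v⟫_ℂ - ⟪u, w⟫_ℂ * ⟪w, v⟫_ℂ) / (1 + ‖w‖ ^ 2 : ℝ) ^ 2 := by
  have e0 : (affineChart n φ).symm w = ray (affineInv n φ w) :=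
    congrFun (coe_affineChart_symm φ) w
  refine (fubiniStudy_congr e0 _ _).trans ?_
  refine (congrArg₂ (fubiniStudy n (ray (affineInv n φ w)))
    (mfderiv_affineChart_symm φ w u) (mfderiv_affineChart_symm φ w v)).trans ?_
  rw [fubiniStudy_rayDeriv (affineInv_ne_zero φ w)]
  have hl : ∀ a : EuclideanSpace ℂ (Fin n), ⟪(φ : H), ((frame n φ).symm a : H)⟫_ℂ = 0 :=
    fun a => Submodule.mem_orthogonal_singleton_iff_inner_right.mp ((frame n φ).symm a).2
  have hr : ∀ a : EuclideanSpace ℂ (Fin n), ⟪((frame n φ).symm a : H), (φ : H)⟫_ℂ = 0 :=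
    fun a => Submodule.mem_orthogonal_singleton_iff_inner_left.mp ((frame n φ).symm a).2
  have hi : ∀ a b : EuclideanSpace ℂ (Fin n),
      ⟪((frame n φ).symm a : H), ((frame n φ).symm b : H)⟫_ℂ = ⟪a, b⟫_ℂ :=
    fun a b => (frame n φ).symm.inner_map_map a b
  have hw : ⟪w, w⟫_ℂ = ((‖w‖ ^ 2 : ℝ) : ℂ) := by
    rw [inner_self_eq_norm_sq_to_K]; push_cast; rfl
  simp only [affineInv, inner_add_left, inner_add_right, hl, hr, hi, hw, inner_self_unit]
  push_cast
  ring

/-- The imaginary part of the Fubini-Study form in an affine chart, in real terms. -/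
theorem chartForm_fubiniStudy_im (φ : Metric.sphere (0 : H) 1)
    (u v w : EuclideanSpace ℂ (Fin n)) :
    (chartForm (M := ℙ ℂ H) (fubiniStudy n) (affineChart n φ) u v w).im =
      (⟪u, v⟫_ℂ).im / (1 + ‖w‖ ^ 2) -
        ((⟪w, u⟫_ℂ).re * (⟪w, v⟫_ℂ).im - (⟪w, u⟫_ℂ).im * (⟪w, v⟫_ℂ).re) /
          (1 + ‖w‖ ^ 2) ^ 2 := by
  have hD : (1 + ‖w‖ ^ 2 : ℝ) ≠ 0 := by positivity
  rw [chartForm_fubiniStudy, ← inner_conj_symm u w, ← Complex.ofReal_pow, Complex.div_ofReal_im,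
    Complex.sub_im, Complex.im_ofReal_mul, Complex.mul_im,
    Complex.conj_re, Complex.conj_im]
  field_simp
  ring

theorem contDiff_chartForm_fubiniStudy (φ : Metric.sphere (0 : H) 1)
    (u v : EuclideanSpace ℂ (Fin n)) :
    ContDiff ℝ ∞ (chartForm (M := ℙ ℂ H) (fubiniStudy n) (affineChart n φ) u v) := by
  have e : chartForm (M := ℙ ℂ H) (fubiniStudy n) (affineChart n φ) u v = fun w =>
      ((1 + ‖w‖ ^ 2 : ℝ) * ⟪u, v⟫_ℂ - ⟪u, w⟫_ℂ * ⟪w, v⟫_ℂ) / (1 + ‖w‖ ^ 2 : ℝ) ^ 2 :=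
    funext fun w => chartForm_fubiniStudy φ u v w
  simp only [e, div_eq_mul_inv]
  have hD : ContDiff ℝ ∞ fun w : EuclideanSpace ℂ (Fin n) => ((1 + ‖w‖ ^ 2 : ℝ) : ℂ) :=
    Complex.ofRealCLM.contDiff.comp (contDiff_const.add (contDiff_id.norm_sq ℂ))
  refine ((hD.mul contDiff_const).sub ((contDiff_const.inner ℂ contDiff_id).mul
    (contDiff_id.inner ℂ contDiff_const))).mul ((hD.pow 2).inv fun w => ?_)
  have : (1 + ‖w‖ ^ 2 : ℝ) ≠ 0 := by positivity
  exact pow_ne_zero 2 (Complex.ofReal_ne_zero.mpr this)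

/-- The derivative of the coordinate expression of `ω`, computed along the line `w + s t`. -/
theorem fderiv_chartForm_fubiniStudy_im (φ : Metric.sphere (0 : H) 1)
    (u v w t : EuclideanSpace ℂ (Fin n)) :
    fderiv ℝ (fun y => (chartForm (M := ℙ ℂ H) (fubiniStudy n) (affineChart n φ) u v y).im) w t =
      -(2 * (⟪w, t⟫_ℂ).re * (⟪u, v⟫_ℂ).im) / (1 + ‖w‖ ^ 2) ^ 2 -
      ((⟪t, u⟫_ℂ).re * (⟪w, v⟫_ℂ).im + (⟪w, u⟫_ℂ).re * (⟪t, v⟫_ℂ).im -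
        (⟪t, u⟫_ℂ).im * (⟪w, v⟫_ℂ).re - (⟪w, u⟫_ℂ).im * (⟪t, v⟫_ℂ).re) / (1 + ‖w‖ ^ 2) ^ 2 +
      4 * (⟪w, t⟫_ℂ).re * ((⟪w, u⟫_ℂ).re * (⟪w, v⟫_ℂ).im - (⟪w, u⟫_ℂ).im * (⟪w, v⟫_ℂ).re) /
        (1 + ‖w‖ ^ 2) ^ 3 := by
  have hd : DifferentiableAt ℝ
      (fun y => (chartForm (M := ℙ ℂ H) (fubiniStudy n) (affineChart n φ) u v y).im) w :=
    (Complex.imCLM.contDiff.comp (contDiff_chartForm_fubiniStudy φ u v)).differentiable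
      (by simp) w
  have hl : HasDerivAt (fun s : ℝ => w + s • t) t 0 := by
    simpa using ((hasDerivAt_id (0 : ℝ)).smul_const t).const_add w
  have hn : HasDerivAt (fun s : ℝ => 1 + ‖w + s • t‖ ^ 2) (2 * (⟪w, t⟫_ℂ).re) 0 := by
    let : InnerProductSpace ℝ (EuclideanSpace ℂ (Fin n)) := InnerProductSpace.complexToReal
    have := hl.norm_sq
    simp only [zero_smul, add_zero] at this
    exact this.const_add 1
  have hc : ∀ a : EuclideanSpace ℂ (Fin n),
      HasDerivAt (fun s : ℝ => ⟪w + s • t, a⟫_ℂ) ⟪t, a⟫_ℂ 0 := fun a => by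
    have := hl.inner ℂ (hasDerivAt_const (0 : ℝ) a)
    simpa only [zero_smul, add_zero, inner_zero_right, zero_add] using this
  have hre : ∀ a : EuclideanSpace ℂ (Fin n),
      HasDerivAt (fun s : ℝ => (⟪w + s • t, a⟫_ℂ).re) (⟪t, a⟫_ℂ).re 0 := fun a =>
    Complex.reCLM.hasFDerivAt.comp_hasDerivAt 0 (hc a)
  have him : ∀ a : EuclideanSpace ℂ (Fin n),
      HasDerivAt (fun s : ℝ => (⟪w + s • t, a⟫_ℂ).im) (⟪t, a⟫_ℂ).im 0 := fun a =>
    Complex.imCLM.hasFDerivAt.comp_hasDerivAt 0 (hc a)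
  have hD : (1 + ‖w‖ ^ 2 : ℝ) ≠ 0 := by positivity
  have h1 := (((hasDerivAt_const (0 : ℝ) (⟪u, v⟫_ℂ).im).div hn (by simpa using hD)).sub
    ((((hre u).mul (him v)).sub ((him u).mul (hre v))).div (hn.pow 2)
      (pow_ne_zero 2 (by simpa using hD))))
  have h2 := (hd.hasFDerivAt.hasLineDerivAt t)
  rw [← h2.lineDeriv, lineDeriv]
  simp only [chartForm_fubiniStudy_im]
  refine h1.deriv.trans ?_
  simp only [zero_smul, add_zero, Pi.mul_apply, Pi.sub_apply, Pi.pow_apply]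
  field_simp
  ring

theorem isKahlerMetric_fubiniStudy : IsKahlerMetric (M := ℙ ℂ H) (fubiniStudy n) where
  add_right x u v w := by
    refine Eq.trans ?_ (inner_add_right _ _ _)
    exact congrArg (fun y => ⟪horizontalLift n u, y⟫_ℂ)
      (congrArg Subtype.val (map_add (frame n (unitRep x)).symm _ _))
  smul_right x u v r := by
    refine Eq.trans ?_ (inner_smul_right _ _ _)
    exact congrArg (fun y => ⟪horizontalLift n u, y⟫_ℂ)
      (congrArg Subtype.val (map_smul (frame n (unitRep x)).symm (r : ℂ) _))
  complexStructure_right x u v := by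
    refine Eq.trans ?_ (inner_smul_right _ _ _)
    exact congrArg (fun y => ⟪horizontalLift n u, y⟫_ℂ)
      (congrArg Subtype.val (map_smul (frame n (unitRep x)).symm Complex.I _))
  conj_symm x u v := inner_conj_symm _ _
  pos_def x u hu := by
    have h0 : horizontalLift n u ≠ 0 := by
      intro h
      refine hu (horizontalLift_injective x (h.trans ?_))
      exact (congrArg Subtype.val (map_zero (frame n (unitRep x)).symm)).symm
    exact (pow_pos (norm_pos_iff.mpr h0) 2).trans_eq
      (inner_self_eq_norm_sq (𝕜 := ℂ) (horizontalLift n u)).symm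
  smooth := by
    rintro _ ⟨φ, rfl⟩ u v
    exact (contDiff_chartForm_fubiniStudy φ u v).contDiffOn
  closed := by
    rintro _ ⟨φ, rfl⟩ w - u v t
    simp only [fderiv_chartForm_fubiniStudy_im]
    have hs : ∀ a b : EuclideanSpace ℂ (Fin n), (⟪a, b⟫_ℂ).re = (⟪b, a⟫_ℂ).re := fun a b => by
      rw [← inner_conj_symm, Complex.conj_re]
    have ha : ∀ a b : EuclideanSpace ℂ (Fin n), (⟪a, b⟫_ℂ).im = -(⟪b, a⟫_ℂ).im := fun a b => by
      rw [← inner_conj_symm, Complex.conj_im]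
    have hD : (1 + ‖w‖ ^ 2 : ℝ) ≠ 0 := by positivity
    -- In a fixed order of the arguments of the inner products, the cyclic sum cancels identically.
    rw [hs t u, hs u v, hs v t, ha t u, ha u v, ha v t]
    field_simp
    ring

end Kahler

/-! ### The principal bundle of phases -/

section Sphere

open Metric

/-- A map into the unit sphere is smooth at a point when it is so as a map into the ambient
space. -/
theorem contMDiffAt_sphere_of_coe {E : Type*} [NormedAddCommGroup E] [InnerProductSpace ℝ E]
    {m : ℕ∞ω} {F : Type*} [NormedAddCommGroup F] [NormedSpace ℝ F] {K : Type*}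
    [TopologicalSpace K] {I : ModelWithCorners ℝ F K} {M : Type*} [TopologicalSpace M]
    [ChartedSpace K M] {k : ℕ} [Fact (finrank ℝ E = k + 1)]
    {f : M → sphere (0 : E) 1} {x : M}
    (hf : ContMDiffAt I 𝓘(ℝ, E) m (fun y => (f y : E)) x) : ContMDiffAt I (𝓡 k) m f x := by
  rw [contMDiffAt_iff_target]
  refine ⟨Topology.IsInducing.subtypeVal.continuousAt_iff.mpr hf.continuousAt, ?_⟩
  let v := f x
  let U := (OrthonormalBasis.fromOrthogonalSpanSingleton (𝕜 := ℝ) k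
        (ne_zero_of_mem_unit_sphere (-v))).repr
  have h1 : ContDiffAt ℝ ω (stereoToFun ((-v : sphere (0 : E) 1) : E)) (f x : E) := by
    refine contDiffOn_stereoToFun.contDiffAt ?_
    refine IsOpen.mem_nhds (isOpen_ne_fun (by fun_prop) continuous_const) ?_
    show ⟪((-v : sphere (0 : E) 1) : E), (v : E)⟫_ℝ ≠ 1
    rw [coe_neg_sphere, inner_neg_left, real_inner_self_eq_norm_sq, norm_eq_of_mem_sphere]
    norm_num
  have h2 : ContDiffAt ℝ m (U ∘ stereoToFun ((-v : sphere (0 : E) 1) : E)) (f x : E) :=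
    (U.contDiff.contDiffAt.comp _ h1).of_le le_top
  exact ContMDiffAt.comp (I' := 𝓘(ℝ, E)) (f := fun y => (f y : E)) x h2.contMDiffAt hf

end Sphere

section PhaseBundle

variable {H : Type*} [NormedAddCommGroup H] [InnerProductSpace ℂ H] {n : ℕ}
  [Fact (finrank ℂ H = n + 1)]

/-- The smooth structure of the unit sphere of a complex space is that of the underlying real inner
product space. -/
theorem contMDiffAt_complexSphere_of_coe {F : Type*} [NormedAddCommGroup F] [NormedSpace ℝ F]
    {K : Type*} [TopologicalSpace K] {I : ModelWithCorners ℝ F K} {M : Type*} [TopologicalSpace M]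
    [ChartedSpace K M] {f : M → Metric.sphere (0 : H) 1} {x : M}
    (hf : ContMDiffAt I 𝓘(ℝ, H) ∞ (fun y => (f y : H)) x) :
    ContMDiffAt I (𝓡 (2 * n + 1)) ∞ f x := by
  let : InnerProductSpace ℝ H := InnerProductSpace.complexToReal
  have : Fact (finrank ℝ H = (2 * n + 1) + 1) := fact_finrank_real (Fact.out : finrank ℂ H = n + 1)
  exact contMDiffAt_sphere_of_coe hf

variable (n) in
theorem contMDiff_coe_complexSphere :
    ContMDiff (𝓡 (2 * n + 1)) 𝓘(ℝ, H) ∞ ((↑) : Metric.sphere (0 : H) 1 → H) := by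
  let : InnerProductSpace ℝ H := InnerProductSpace.complexToReal
  have : Fact (finrank ℝ H = (2 * n + 1) + 1) := fact_finrank_real (Fact.out : finrank ℂ H = n + 1)
  exact contMDiff_coe_sphere

theorem contMDiffAt_circle_of_coe {F : Type*} [NormedAddCommGroup F] [NormedSpace ℝ F]
    {K : Type*} [TopologicalSpace K] {I : ModelWithCorners ℝ F K} {M : Type*} [TopologicalSpace M]
    [ChartedSpace K M] {f : M → Circle} {x : M}
    (hf : ContMDiffAt I 𝓘(ℝ, ℂ) ∞ (fun y => (f y : ℂ)) x) :
    ContMDiffAt I (𝓡 1) ∞ f x := by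
  have : Fact (finrank ℝ ℂ = 1 + 1) := Complex.finrank_real_complex_fact
  exact contMDiffAt_sphere_of_coe (E := ℂ) (M := M) (f := (f : M → Metric.sphere (0 : ℂ) 1)) hf

theorem contMDiff_coe_circle : ContMDiff (𝓡 1) 𝓘(ℝ, ℂ) ∞ (fun z : Circle => (z : ℂ)) := by
  have : Fact (finrank ℝ ℂ = 1 + 1) := Complex.finrank_real_complex_fact
  have h : ContMDiff (𝓡 1) 𝓘(ℝ, ℂ) ∞ ((↑) : Metric.sphere (0 : ℂ) 1 → ℂ) :=
    contMDiff_coe_sphere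
  exact h

theorem contDiffAt_normalize {E : Type*} [NormedAddCommGroup E] [InnerProductSpace ℂ E] {v : E}
    (h : v ≠ 0) : ContDiffAt ℝ ∞ (fun y : E => (‖y‖⁻¹ : ℝ) • y) v :=
  ((contDiffAt_norm ℂ h).inv (norm_ne_zero_iff.mpr h)).smul contDiffAt_id

/-- The unit vector on the ray `x` whose product with `φ` is positive; it is defined near the ray
of `φ`. -/
def phaseSection (n : ℕ) [Fact (finrank ℂ H = n + 1)] (φ : Metric.sphere (0 : H) 1) (x : ℙ ℂ H) :
    Metric.sphere (0 : H) 1 :=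
  ⟨(‖affineInv n φ (affineChart n φ x)‖⁻¹ : ℝ) • affineInv n φ (affineChart n φ x), by
    have h := norm_ne_zero_iff.mpr (affineInv_ne_zero φ (affineChart n φ x))
    rw [mem_sphere_zero_iff_norm, norm_smul, norm_inv, norm_norm, inv_mul_cancel₀ h]⟩

open Classical in
/-- The phase of `⟪φ, p⟫`. The value where this product vanishes is irrelevant. -/
def relativePhase (φ p : Metric.sphere (0 : H) 1) : Circle :=
  if h : ⟪(φ : H), (p : H)⟫_ℂ = 0 then 1 else
    ⟨(‖⟪(φ : H), (p : H)⟫_ℂ‖⁻¹ : ℝ) • ⟪(φ : H), (p : H)⟫_ℂ, by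
      show _ ∈ Metric.sphere (0 : ℂ) 1
      rw [mem_sphere_zero_iff_norm, norm_smul, norm_inv, norm_norm,
        inv_mul_cancel₀ (norm_ne_zero_iff.mpr h)]⟩

theorem coe_relativePhase {φ p : Metric.sphere (0 : H) 1} (h : ⟪(φ : H), (p : H)⟫_ℂ ≠ 0) :
    (relativePhase φ p : ℂ) = (‖⟪(φ : H), (p : H)⟫_ℂ‖⁻¹ : ℝ) • ⟪(φ : H), (p : H)⟫_ℂ := by
  exact congrArg (fun z : Circle => (z : ℂ)) (dif_neg h)

theorem inner_phaseSection (φ : Metric.sphere (0 : H) 1) (x : ℙ ℂ H) :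
    ⟪(φ : H), (phaseSection n φ x : H)⟫_ℂ =
      (‖affineInv n φ (affineChart n φ x)‖⁻¹ : ℝ) := by
  show ⟪(φ : H), (‖affineInv n φ (affineChart n φ x)‖⁻¹ : ℝ) •
    affineInv n φ (affineChart n φ x)⟫_ℂ = _
  rw [← Complex.coe_smul, inner_smul_right, inner_affineInv, mul_one]

theorem relativePhase_act_phaseSection (φ : Metric.sphere (0 : H) 1) (x : ℙ ℂ H) (g : Circle) :
    relativePhase φ (phaseAct g (phaseSection n φ x)) = g := by
  have h0 : (0 : ℝ) < ‖affineInv n φ (affineChart n φ x)‖⁻¹ :=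
    inv_pos.mpr (norm_pos_iff.mpr (affineInv_ne_zero φ _))
  have h1 : ⟪(φ : H), (phaseAct g (phaseSection n φ x) : H)⟫_ℂ =
      g * (‖affineInv n φ (affineChart n φ x)‖⁻¹ : ℝ) := by
    show ⟪(φ : H), (g : ℂ) • (phaseSection n φ x : H)⟫_ℂ = _
    rw [inner_smul_right, inner_phaseSection]
  have h2 : (g : ℂ) * (‖affineInv n φ (affineChart n φ x)‖⁻¹ : ℝ) ≠ 0 :=
    mul_ne_zero (Circle.coe_ne_zero g) (Complex.ofReal_ne_zero.mpr h0.ne')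
  refine Circle.ext ?_
  rw [coe_relativePhase (h1 ▸ h2), h1, norm_mul, Circle.norm_coe, one_mul, Complex.norm_real,
    Real.norm_of_nonneg h0.le, Complex.real_smul, mul_left_comm, ← Complex.ofReal_mul,
    inv_mul_cancel₀ h0.ne', Complex.ofReal_one, mul_one]

variable [Nontrivial H]

theorem phaseProj_eq_ray (p : Metric.sphere (0 : H) 1) : phaseProj p = ray (p : H) :=
  (ray_eq_mk _).symm

theorem phaseProj_phaseSection (φ : Metric.sphere (0 : H) 1) {x : ℙ ℂ H}
    (hx : x ∈ (affineChart n φ).source) : phaseProj (phaseSection n φ x) = x := by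
  have h0 : (‖affineInv n φ (affineChart n φ x)‖⁻¹ : ℂ) ≠ 0 := by
    simpa using affineInv_ne_zero φ (affineChart n φ x)
  have e : (phaseSection n φ x : H) = (‖affineInv n φ (affineChart n φ x)‖⁻¹ : ℂ) •
      affineInv n φ (affineChart n φ x) := by
    rw [← Complex.ofReal_inv]; rfl
  rw [phaseProj_eq_ray, e, ray_smul h0]
  exact (congrFun (coe_affineChart_symm φ) _).symm.trans ((affineChart n φ).left_inv hx)

theorem relativePhase_act_phaseSection_proj (φ : Metric.sphere (0 : H) 1)
    {p : Metric.sphere (0 : H) 1} (h : ⟪(φ : H), (p : H)⟫_ℂ ≠ 0) :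
    phaseAct (relativePhase φ p) (phaseSection n φ (phaseProj p)) = p := by
  have hp : (p : H) ≠ 0 := ne_zero_of_mem_unit_sphere p
  have e : affineInv n φ (affineChart n φ (phaseProj p)) =
      (⟪(φ : H), (p : H)⟫_ℂ)⁻¹ • (p : H) := by
    rw [phaseProj_eq_ray, affineChart_ray φ hp, affineInv_affineCoord φ h]
  refine Subtype.ext ?_
  show (relativePhase φ p : ℂ) • ((‖affineInv n φ (affineChart n φ (phaseProj p))‖⁻¹ : ℝ) •
    affineInv n φ (affineChart n φ (phaseProj p))) = (p : H)
  have hn : (‖⟪(φ : H), (p : H)⟫_ℂ‖ : ℂ) ≠ 0 := by simpa using h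
  rw [coe_relativePhase h, e, norm_smul, norm_eq_of_mem_sphere p, mul_one, norm_inv, inv_inv,
    Complex.real_smul, ← Complex.coe_smul, smul_smul, smul_smul]
  convert one_smul ℂ (p : H)
  push_cast
  field_simp

/-- Over the domain of the affine chart of `φ`, the normalised point `φ + w` is a section and the
phase of `⟪φ, ·⟫` the matching group coordinate. -/
theorem isPrincipalBundle_phaseProj :
    IsPrincipalBundle (𝓡 1) (𝓡 (2 * n + 1)) 𝓘(ℝ, EuclideanSpace ℂ (Fin n))
      (phaseAct : Circle → Metric.sphere (0 : H) 1 → Metric.sphere (0 : H) 1) phaseProj where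
  contMDiff_proj p := by
    have h := (contMDiffAt_ray n (ne_zero_of_mem_unit_sphere p)).comp p
      (contMDiff_coe_complexSphere n p)
    exact h.congr_of_eventuallyEq (Filter.Eventually.of_forall phaseProj_eq_ray)
  surjective_proj x := ⟨unitRep x, by rw [phaseProj_eq_ray, ray_unitRep]⟩
  contMDiff_act p := by
    refine contMDiffAt_complexSphere_of_coe ?_
    have h : ContDiff ℝ ∞ fun q : ℂ × H => q.1 • q.2 := contDiff_fst.smul contDiff_snd
    exact h.comp_contMDiffAt
      (((contMDiff_coe_circle.contMDiffAt (x := p.1)).comp p contMDiffAt_fst).prodMk_space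
        (((contMDiff_coe_complexSphere n).contMDiffAt (x := p.2)).comp p contMDiffAt_snd))
  one_act p := Subtype.ext (one_smul ℂ (p : H))
  mul_act g g' p := Subtype.ext (mul_smul (g : ℂ) (g' : ℂ) (p : H))
  proj_act g p := by
    rw [phaseProj_eq_ray, phaseProj_eq_ray]
    exact ray_smul (Circle.coe_ne_zero g)
  locally_trivial b := by
    set φ := unitRep b
    have hU : ∀ p : Metric.sphere (0 : H) 1, phaseProj p ∈ (affineChart n φ).source →
        ⟪(φ : H), (p : H)⟫_ℂ ≠ 0 := fun p hp => by
      rw [phaseProj_eq_ray] at hp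
      exact (mem_affineChart_source_ray φ (ne_zero_of_mem_unit_sphere p)).mp hp
    refine ⟨(affineChart n φ).source, (affineChart n φ).open_source,
      mem_chart_source (EuclideanSpace ℂ (Fin n)) b, phaseSection n φ, relativePhase φ,
      fun x hx => ?_, fun p hp => ?_, fun x hx => phaseProj_phaseSection φ hx,
      fun x _ g => relativePhase_act_phaseSection φ x g,
      fun p hp => relativePhase_act_phaseSection_proj φ (hU p hp)⟩
    · refine (contMDiffAt_complexSphere_of_coe ?_).contMDiffWithinAt
      have h1 : ContMDiffAt 𝓘(ℝ, EuclideanSpace ℂ (Fin n)) 𝓘(ℝ, EuclideanSpace ℂ (Fin n)) ∞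
          (affineChart n φ) x :=
        contMDiffAt_of_mem_maximalAtlas (affineChart_mem_maximalAtlas φ) hx
      exact (((contDiffAt_normalize (affineInv_ne_zero φ _)).comp (affineChart n φ x)
        (contDiff_real_affineInv φ).contDiffAt).contMDiffAt.comp x h1)
    · refine (contMDiffAt_circle_of_coe ?_).contMDiffWithinAt
      have h1 : ContMDiffAt (𝓡 (2 * n + 1)) 𝓘(ℝ, ℂ) ∞
          (fun q : Metric.sphere (0 : H) 1 => ⟪(φ : H), (q : H)⟫_ℂ) p :=
        (((innerSL ℂ (φ : H)).restrictScalars ℝ).contMDiff.contMDiffAt).comp p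
          (contMDiff_coe_complexSphere n p)
      have h2 := (contDiffAt_normalize (hU p hp)).contMDiffAt.comp p h1
      refine h2.congr_of_eventuallyEq ?_
      filter_upwards [((isOpen_inner_ne_zero (φ : H)).preimage
        continuous_subtype_val).mem_nhds (hU p hp)] with q hq
      exact coe_relativePhase hq

end PhaseBundle

/-! ### The Schrödinger vector field -/

section Anchor

variable {H : Type*} [NormedAddCommGroup H] [InnerProductSpace ℂ H] [CompleteSpace H]

theorem observable_inner_left (A : Observable H) (u v : H) :
    ⟪(A : H →L[ℂ] H) u, v⟫_ℂ = ⟪u, (A : H →L[ℂ] H) v⟫_ℂ :=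
  ContinuousLinearMap.isSelfAdjoint_iff_isSymmetric.mp A.2 u v

theorem observable_inner_self_im (A : Observable H) (ψ : H) :
    (⟪ψ, (A : H →L[ℂ] H) ψ⟫_ℂ).im = 0 := by
  rw [← Complex.conj_eq_iff_im, inner_conj_symm, observable_inner_left]

theorem schrodingerVector_eq_I_smul [FiniteDimensional ℂ H] {ħ : ℝ} (hħ : ħ ≠ 0)
    (A : Observable H) (ψ : H) :
    schrodingerVector ħ A ψ = Complex.I • (A : H →L[ℂ] H) ψ := by
  rw [schrodingerVector_eq, mul_assoc, mul_inv_cancel₀ (Complex.ofReal_ne_zero.mpr hħ), mul_one]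

section Flow

theorem skewAdjoint_smul_observable (A : Observable H) (t : ℝ) :
    (t * Complex.I : ℂ) • (A : H →L[ℂ] H) ∈ skewAdjoint (H →L[ℂ] H) := by
  have hA : star (A : H →L[ℂ] H) = A := A.2
  rw [skewAdjoint.mem_iff, star_smul, hA, ← neg_smul]
  simp

theorem unitaryFlow_mem_unitary (A : Observable H) (t : ℝ) :
    unitaryFlow A t ∈ unitary (H →L[ℂ] H) := by
  let : NormedAlgebra ℚ (H →L[ℂ] H) := NormedAlgebra.restrictScalars ℚ ℂ _
  exact NormedSpace.exp_mem_unitary_of_mem_skewAdjoint (skewAdjoint_smul_observable A t)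

theorem unitaryFlow_ne_zero (A : Observable H) (t : ℝ) {ψ : H} (h : ψ ≠ 0) :
    unitaryFlow A t ψ ≠ 0 :=
  unitary_apply_ne_zero ⟨_, unitaryFlow_mem_unitary A t⟩ h

theorem hasDerivAt_unitaryFlow (A : Observable H) (ψ : H) (t : ℝ) :
    HasDerivAt (fun s => unitaryFlow A s ψ)
      (Complex.I • (A : H →L[ℂ] H) (unitaryFlow A t ψ)) t := by
  have e : ∀ s : ℝ, unitaryFlow A s = NormedSpace.exp (s • (Complex.I • (A : H →L[ℂ] H))) :=
    fun s => by rw [unitaryFlow, mul_smul, Complex.coe_smul]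
  have h := hasDerivAt_exp_smul_const' (𝕂 := ℝ) (Complex.I • (A : H →L[ℂ] H)) t
  simp only [← e] at h
  exact (((ContinuousLinearMap.apply ℂ H ψ).restrictScalars ℝ).hasFDerivAt.comp_hasDerivAt t h)

end Flow

section Expectation

theorem contDiff_hamiltonian (A : Observable H) : ContDiff ℝ ∞ (hamiltonian A) :=
  contDiff_id.inner ℂ ((A : H →L[ℂ] H).restrictScalars ℝ).contDiff

variable [Nontrivial H]

theorem expectation_ray (A : Observable H) {ψ : H} (h : ψ ≠ 0) :
    expectation A (ray ψ) = (hamiltonian A ψ).re / ‖ψ‖ ^ 2 := by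
  obtain ⟨c, hc⟩ := Projectivization.exists_smul_eq_mk_rep ℂ ψ h
  have hc0 : (‖(c : ℂ)‖ : ℝ) ^ 2 ≠ 0 := by simp
  have hi : hamiltonian A ((c : ℂ) • ψ) = ((‖(c : ℂ)‖ ^ 2 : ℝ) : ℂ) * hamiltonian A ψ := by
    rw [hamiltonian, map_smul, inner_smul_left, inner_smul_right, ← mul_assoc,
      Complex.conj_mul', Complex.ofReal_pow]
    rfl
  rw [ray_eq_mk h, expectation, ← hc, Units.smul_def, hi, Complex.re_ofReal_mul, norm_smul,
    mul_pow, mul_div_mul_left _ _ hc0]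

theorem expectation_ray_eventuallyEq (A : Observable H) {ψ : H} (h : ψ ≠ 0) :
    (fun y => expectation A (ray y)) =ᶠ[nhds ψ] fun y => (hamiltonian A y).re / ‖y‖ ^ 2 := by
  filter_upwards [isOpen_ne.mem_nhds h] with y hy using expectation_ray A hy

theorem contDiffAt_expectation_ray (A : Observable H) {ψ : H} (h : ψ ≠ 0) :
    ContDiffAt ℝ ∞ (fun y => expectation A (ray y)) ψ := by
  have h1 : ContDiffAt ℝ ∞ (fun y => (hamiltonian A y).re / ‖y‖ ^ 2) ψ :=
    (Complex.reCLM.contDiff.comp (contDiff_hamiltonian A)).contDiffAt.div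
      (contDiff_id.norm_sq ℂ).contDiffAt (pow_ne_zero 2 (norm_ne_zero_iff.mpr h))
  exact h1.congr_of_eventuallyEq (expectation_ray_eventuallyEq A h)

/-- The quotient rule for the expectation value at a unit vector. -/
theorem fderiv_expectation_ray (A : Observable H) {ψ : H} (h : ‖ψ‖ = 1) (v : H) :
    fderiv ℝ (fun y => expectation A (ray y)) ψ v =
      2 * (⟪(A : H →L[ℂ] H) ψ, v⟫_ℂ).re -
        2 * (⟪ψ, (A : H →L[ℂ] H) ψ⟫_ℂ).re * (⟪ψ, v⟫_ℂ).re := by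
  have h0 : ψ ≠ 0 := by
    rintro rfl
    simp at h
  have hd := ((contDiff_hamiltonian A).differentiable (by simp) ψ).hasFDerivAt
  have h1 : HasFDerivAt (fun y => (hamiltonian A y).re) _ ψ := Complex.reCLM.hasFDerivAt.comp ψ hd
  have h2 : HasFDerivAt (fun y : H => ‖y‖ ^ 2)
      (2 • (Complex.reCLM.comp ((innerSL ℂ ψ).restrictScalars ℝ))) ψ := by
    let : InnerProductSpace ℝ H := InnerProductSpace.complexToReal
    exact (hasStrictFDerivAt_norm_sq ψ).hasFDerivAt
  have h3 := h1.mul ((hasDerivAt_inv (pow_ne_zero 2 (norm_ne_zero_iff.mpr h0))).comp_hasFDerivAt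
    ψ h2)
  refine (congrArg (fun L : H →L[ℝ] ℝ => L v)
    ((expectation_ray_eventuallyEq A h0).fderiv_eq.trans h3.fderiv)).trans ?_
  simp [h, fderiv_hamiltonian, hamiltonian]
  ring

theorem expectation_ray_eq_sum [FiniteDimensional ℂ H] {ι : Type*} [Fintype ι] (A : Observable H)
    (b : OrthonormalBasis ι ℂ H) (a : ι → ℝ)
    (hb : ∀ k, (A : H →L[ℂ] H) (b k) = (a k : ℂ) • b k) {ψ : H} (h : ‖ψ‖ = 1) :
    expectation A (ray ψ) = ∑ k, a k * ‖⟪b k, ψ⟫_ℂ‖ ^ 2 := by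
  have h0 : ψ ≠ 0 := by
    rintro rfl
    simp at h
  rw [expectation_ray A h0, h, one_pow, div_one, hamiltonian,
    ← b.sum_inner_mul_inner ψ ((A : H →L[ℂ] H) ψ), Complex.re_sum]
  refine Finset.sum_congr rfl fun k _ => ?_
  rw [← observable_inner_left, hb, inner_smul_left, Complex.conj_ofReal, mul_left_comm,
    ← inner_conj_symm ψ, Complex.conj_mul', Complex.re_ofReal_mul]
  norm_cast

end Expectation

variable [FiniteDimensional ℂ H] [Nontrivial H] {n : ℕ} [Fact (finrank ℂ H = n + 1)] {ħ : ℝ}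

/-- The anchor may be computed with any nonzero vector of the ray, because the Schrödinger vector is
complex homogeneous. -/
theorem schrodingerAnchor_ray (hħ : ħ ≠ 0) (A : Observable H) {ψ : H} (h : ψ ≠ 0) :
    schrodingerAnchor n ħ (ray ψ) A = rayDeriv n ψ (Complex.I • (A : H →L[ℂ] H) ψ) := by
  obtain ⟨c, hc, e⟩ := exists_eq_smul_unitRep h
  have h1 := rayDeriv_smul (n := n) (unitRep_ne_zero (ray ψ)) hc
    (Complex.I • (A : H →L[ℂ] H) (unitRep (ray ψ)))
  rw [smul_comm c, ← map_smul, ← e] at h1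
  refine Eq.trans ?_ h1.symm
  exact congrArg (fun y => (rayDeriv n (unitRep (ray ψ) : H) y : EuclideanSpace ℂ (Fin n)))
    (schrodingerVector_eq_I_smul hħ A _)

/-- For `‖ψ‖ = 1` both sides are `-Re ⟪A ψ, v⟫ + ⟪ψ, A ψ⟫ Re ⟪ψ, v⟫` at the image of `v`. -/
theorem schrodingerAnchor_hamiltonian (hħ : ħ ≠ 0) (A : Observable H) (x : ℙ ℂ H)
    (u : TangentSpace 𝓘(ℝ, EuclideanSpace ℂ (Fin n)) x) :
    (fubiniStudy n x (schrodingerAnchor n ħ x A) u).im =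
      -(1 / 2) * dirDeriv 𝓘(ℝ, EuclideanSpace ℂ (Fin n)) (expectation A) x u := by
  obtain ⟨ψ, h, rfl⟩ : ∃ ψ : H, ‖ψ‖ = 1 ∧ ray ψ = x :=
    ⟨unitRep x, norm_eq_of_mem_sphere _, ray_unitRep x⟩
  have h0 : ψ ≠ 0 := by
    rintro rfl
    simp at h
  obtain ⟨v, rfl⟩ := rayDeriv_surjective h0 u
  have hs : ContMDiff 𝓘(ℝ, EuclideanSpace ℂ (Fin n)) 𝓘(ℝ, ℝ) ∞ (expectation A) :=
    contMDiff_of_comp_ray fun y hy => (contDiffAt_expectation_ray A hy).contMDiffAt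
  have h1 : dirDeriv 𝓘(ℝ, EuclideanSpace ℂ (Fin n)) (expectation A) (ray ψ) (rayDeriv n ψ v) =
      fderiv ℝ (fun y => expectation A (ray y)) ψ v := by
    refine (mfderiv_comp_ray h0 (hs.mdifferentiable (by simp) _) v).trans ?_
    rw [mfderiv_eq_fderiv]
    rfl
  have hψ : ⟪ψ, ψ⟫_ℂ = 1 := by
    rw [inner_self_eq_norm_sq_to_K, h]; simp
  rw [h1, fderiv_expectation_ray A h, schrodingerAnchor_ray hħ A h0, fubiniStudy_rayDeriv h0, hψ,
    inner_smul_left, inner_smul_left, observable_inner_left A ψ ψ]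
  have hi := observable_inner_self_im A ψ
  simp [hi]
  ring

theorem isMIntegralCurve_ray_unitaryFlow (hħ : ħ ≠ 0) (A : Observable H) {ψ : H} (h : ψ ≠ 0) :
    IsMIntegralCurve (I := 𝓘(ℝ, EuclideanSpace ℂ (Fin n)))
      (fun t => ray (unitaryFlow A t ψ)) (fun x => schrodingerAnchor n ħ x A) := by
  intro t
  have h0 := unitaryFlow_ne_zero A t h
  have h1 := (mdifferentiableAt_ray (n := n) h0).hasMFDerivAt.comp t
    (hasDerivAt_unitaryFlow A ψ t).hasFDerivAt.hasMFDerivAt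
  have h2 : ((1 : ℝ →L[ℝ] ℝ).smulRight
      (schrodingerAnchor n ħ (ray (unitaryFlow A t ψ)) A : EuclideanSpace ℂ (Fin n))) =
      (rayDeriv n (unitaryFlow A t ψ) : H →L[ℝ] EuclideanSpace ℂ (Fin n)).comp
        ((1 : ℝ →L[ℝ] ℝ).smulRight (Complex.I • (A : H →L[ℂ] H) (unitaryFlow A t ψ))) := by
    refine ContinuousLinearMap.ext_ring ?_
    rw [ContinuousLinearMap.comp_apply, ContinuousLinearMap.smulRight_apply,
      ContinuousLinearMap.smulRight_apply, one_apply_eq_self, one_smul, one_smul]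
    exact schrodingerAnchor_ray hħ A h0
  exact h2 ▸ h1

theorem schrodingerAnchor_eq_zero_iff (hħ : ħ ≠ 0) (A : Observable H) {ψ : H} (h : ψ ≠ 0) :
    schrodingerAnchor n ħ (ray ψ) A = 0 ↔ ∃ a : ℝ, (A : H →L[ℂ] H) ψ = (a : ℂ) • ψ := by
  have h0 : ⟪ψ, ψ⟫_ℂ ≠ 0 := inner_self_ne_zero.mpr h
  rw [schrodingerAnchor_ray hħ A h, rayDeriv_eq_zero_iff h]
  constructor
  · rintro ⟨c, hc⟩
    -- `i A ψ = c ψ` gives the eigenvalue `-i c`, which is real because `A` is symmetric.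
    have e : (A : H →L[ℂ] H) ψ = (-Complex.I * c) • ψ := by
      rw [mul_smul, ← hc, smul_smul]; simp
    refine ⟨(-Complex.I * c).re, ?_⟩
    have hs := observable_inner_left A ψ ψ
    rw [e, inner_smul_left, inner_smul_right] at hs
    rw [Complex.conj_eq_iff_re.mp (mul_right_cancel₀ h0 hs), e]
  · rintro ⟨a, ha⟩
    exact ⟨Complex.I * a, by rw [ha, smul_smul]⟩

end Anchor

/-! ### The action algebroid of a linear action on a normed space -/

section ActionAlgebroid

open VectorField

variable {E : Type*} [NormedAddCommGroup E] [NormedSpace ℝ E]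

theorem two_le_infty : (2 : ℕ∞ω) ≤ ∞ := WithTop.coe_le_coe.mpr le_top

/-- Vector fields `X` and `Y` that a smooth map `P` takes to `V` and `W` have a Lie bracket that
`P` takes to the Lie bracket of `V` and `W`. -/
theorem lieBracket_of_related {F : Type*} [NormedAddCommGroup F] [NormedSpace ℝ F]
    {P : E → F} {X Y : E → E} {V W : F → F} {x : E} (hP : ContDiffAt ℝ ∞ P x)
    (hX : DifferentiableAt ℝ X x) (hY : DifferentiableAt ℝ Y x)
    (hV : DifferentiableAt ℝ V (P x)) (hW : DifferentiableAt ℝ W (P x))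
    (hXV : (fun y => fderiv ℝ P y (X y)) =ᶠ[nhds x] fun y => V (P y))
    (hYW : (fun y => fderiv ℝ P y (Y y)) =ᶠ[nhds x] fun y => W (P y)) :
    lieBracket ℝ V W (P x) = fderiv ℝ P x (lieBracket ℝ X Y x) := by
  have hd := hP.differentiableAt (by simp)
  rw [fderiv_apply_lieBracket hP (by simpa using two_le_infty) hY hX, hXV.fderiv_eq,
    hYW.fderiv_eq, fderiv_fun_comp x hV hd, fderiv_fun_comp x hW hd,
    ContinuousLinearMap.comp_apply, ContinuousLinearMap.comp_apply]
  exact congrArg₂ (fun a b => fderiv ℝ W (P x) a - fderiv ℝ V (P x) b)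
    hXV.eq_of_nhds.symm hYW.eq_of_nhds.symm

variable {𝔤 : Type*} [NormedAddCommGroup 𝔤] [NormedSpace ℝ 𝔤]
  (B : 𝔤 →L[ℝ] 𝔤 →L[ℝ] 𝔤) (ρ : 𝔤 →L[ℝ] E →L[ℝ] E)

/-- The vector field on `E` that a `𝔤`-valued function `a` generates through the linear
representation `ρ`. -/
def actionField (a : E → 𝔤) (y : E) : E := ρ (a y) y

/-- The bracket of the action Lie algebroid of `ρ` on `𝔤`-valued functions: the pointwise
bracket `B`, corrected by the derivatives along the generated vector fields. -/
def actionBracket (a b : E → 𝔤) (y : E) : 𝔤 :=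
  B (a y) (b y) + fderiv ℝ b y (actionField ρ a y) - fderiv ℝ a y (actionField ρ b y)

variable {B ρ}

theorem contDiffAt_actionField {a : E → 𝔤} {y : E} {m : ℕ∞ω} (ha : ContDiffAt ℝ m a y) :
    ContDiffAt ℝ m (actionField ρ a) y :=
  (ρ.contDiff.contDiffAt.comp y ha).clm_apply contDiffAt_id

theorem contDiffAt_fderiv_actionField {F : Type*} [NormedAddCommGroup F] [NormedSpace ℝ F]
    {a : E → 𝔤} {f : E → F} {y : E} (ha : ContDiffAt ℝ ∞ a y) (hf : ContDiffAt ℝ ∞ f y) :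
    ContDiffAt ℝ ∞ (fun z => fderiv ℝ f z (actionField ρ a z)) y :=
  (hf.fderiv_right (by simp)).clm_apply (contDiffAt_actionField ha)

theorem contDiffAt_actionBracket {a b : E → 𝔤} {y : E} (ha : ContDiffAt ℝ ∞ a y)
    (hb : ContDiffAt ℝ ∞ b y) : ContDiffAt ℝ ∞ (actionBracket B ρ a b) y :=
  (((B.contDiff.contDiffAt.comp y ha).clm_apply hb).add
    (contDiffAt_fderiv_actionField ha hb)).sub (contDiffAt_fderiv_actionField hb ha)

theorem fderiv_actionField {a : E → 𝔤} {y : E} (ha : DifferentiableAt ℝ a y) (u : E) :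
    fderiv ℝ (actionField ρ a) y u = ρ (fderiv ℝ a y u) y + ρ (a y) u := by
  have h := ρ.hasFDerivAt_of_bilinear ha.hasFDerivAt (hasFDerivAt_id (𝕜 := ℝ) y)
  have h' : HasFDerivAt (actionField ρ a) _ y := h
  rw [h'.fderiv]
  simp [add_comm]

/-- The generated vector fields close under the Lie bracket when `ρ` is an antihomomorphism. -/
theorem lieBracket_actionField
    (hρ : ∀ a b v, ρ (B a b) v = ρ b (ρ a v) - ρ a (ρ b v))
    {a b : E → 𝔤} {y : E} (ha : DifferentiableAt ℝ a y) (hb : DifferentiableAt ℝ b y) :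
    lieBracket ℝ (actionField ρ a) (actionField ρ b) y =
      actionField ρ (actionBracket B ρ a b) y := by
  simp only [lieBracket, fderiv_actionField ha, fderiv_actionField hb]
  simp only [actionField, actionBracket, map_add, map_sub, add_apply,
    sub_apply, hρ]
  abel

/-- The iterated bracket, expanded. The derivative of `a` along the vector field generated by the
inner bracket is a commutator of second derivatives, since that field is a Lie bracket. -/
theorem actionBracket_actionBracket
    (hρ : ∀ a b v, ρ (B a b) v = ρ b (ρ a v) - ρ a (ρ b v))
    {a b c : E → 𝔤} {y : E} (ha : ContDiffAt ℝ ∞ a y) (hb : ContDiffAt ℝ ∞ b y)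
    (hc : ContDiffAt ℝ ∞ c y) :
    actionBracket B ρ a (actionBracket B ρ b c) y =
      B (a y) (B (b y) (c y)) + B (a y) (fderiv ℝ c y (actionField ρ b y)) -
        B (a y) (fderiv ℝ b y (actionField ρ c y)) +
      (B (b y) (fderiv ℝ c y (actionField ρ a y)) +
        B (fderiv ℝ b y (actionField ρ a y)) (c y) +
        fderiv ℝ (fun z => fderiv ℝ c z (actionField ρ b z)) y (actionField ρ a y) -
        fderiv ℝ (fun z => fderiv ℝ b z (actionField ρ c z)) y (actionField ρ a y)) -
      (fderiv ℝ (fun z => fderiv ℝ a z (actionField ρ c z)) y (actionField ρ b y) -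
        fderiv ℝ (fun z => fderiv ℝ a z (actionField ρ b z)) y (actionField ρ c y)) := by
  have hd : ∀ {f : E → 𝔤}, ContDiffAt ℝ ∞ f y → DifferentiableAt ℝ f y :=
    fun h => h.differentiableAt (by simp)
  have h1 := fderiv_apply_lieBracket ha (by simpa using two_le_infty)
    ((contDiffAt_actionField (ρ := ρ) hc).differentiableAt (by simp))
    ((contDiffAt_actionField (ρ := ρ) hb).differentiableAt (by simp))
  rw [lieBracket_actionField hρ (hd hb) (hd hc)] at h1
  have h2 := ((B.hasFDerivAt_of_bilinear (hd hb).hasFDerivAt (hd hc).hasFDerivAt).add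
    (hd (contDiffAt_fderiv_actionField (ρ := ρ) hb hc)).hasFDerivAt).sub
    (hd (contDiffAt_fderiv_actionField (ρ := ρ) hc hb)).hasFDerivAt
  have h3 : HasFDerivAt (actionBracket B ρ b c) _ y := h2
  rw [actionBracket, h1, h3.fderiv]
  simp only [actionBracket, map_add, map_sub, add_apply,
    sub_apply, ContinuousLinearMap.precompR_apply,
    ContinuousLinearMap.precompL_apply]
  rfl

/-- The Jacobi identity of the action algebroid: the derivatives along the generated vector
fields satisfy the commutation relations of the bracket. -/
theorem actionBracket_jacobi (hB : ∀ a b, B a b = - B b a)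
    (hJ : ∀ a b c, B a (B b c) + B b (B c a) + B c (B a b) = 0)
    (hρ : ∀ a b v, ρ (B a b) v = ρ b (ρ a v) - ρ a (ρ b v))
    {a b c : E → 𝔤} {y : E} (ha : ContDiffAt ℝ ∞ a y) (hb : ContDiffAt ℝ ∞ b y)
    (hc : ContDiffAt ℝ ∞ c y) :
    actionBracket B ρ a (actionBracket B ρ b c) y +
      actionBracket B ρ b (actionBracket B ρ c a) y +
      actionBracket B ρ c (actionBracket B ρ a b) y = 0 := by
  rw [actionBracket_actionBracket hρ ha hb hc, actionBracket_actionBracket hρ hb hc ha,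
    actionBracket_actionBracket hρ hc ha hb, ← hJ (a y) (b y) (c y),
    hB (fderiv ℝ b y _) (c y), hB (fderiv ℝ c y _) (a y), hB (fderiv ℝ a y _) (b y)]
  abel

theorem actionBracket_antisymm (hB : ∀ a b, B a b = - B b a) (a b : E → 𝔤) (y : E) :
    actionBracket B ρ a b y = - actionBracket B ρ b a y := by
  rw [actionBracket, actionBracket, hB]
  abel

theorem actionBracket_congr_right {a b c : E → 𝔤} {y : E} (h : b =ᶠ[nhds y] c) :
    actionBracket B ρ a b y = actionBracket B ρ a c y := by
  simp only [actionBracket, actionField, h.fderiv_eq, h.eq_of_nhds]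

theorem actionBracket_add {a b c : E → 𝔤} {y : E} (hb : DifferentiableAt ℝ b y)
    (hc : DifferentiableAt ℝ c y) :
    actionBracket B ρ a (fun z => b z + c z) y =
      actionBracket B ρ a b y + actionBracket B ρ a c y := by
  simp only [actionBracket, actionField, fderiv_fun_add hb hc, map_add, add_apply]
  abel

theorem actionBracket_smul {a b : E → 𝔤} {f : E → ℝ} {y : E} (hf : DifferentiableAt ℝ f y)
    (hb : DifferentiableAt ℝ b y) :
    actionBracket B ρ a (fun z => f z • b z) y =
      fderiv ℝ f y (actionField ρ a y) • b y + f y • actionBracket B ρ a b y := by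
  simp only [actionBracket, actionField, fderiv_fun_smul hf hb, map_smul, add_apply, smul_apply,
    ContinuousLinearMap.smulRight_apply]
  module

/-- A function that is constant on the lines through the origin has a derivative that is constant
along them, when the direction is rescaled as well. -/
theorem fderiv_smul_of_homogeneous {F : Type*} [NormedAddCommGroup F] [NormedSpace ℝ F]
    {E : Type*} [NormedAddCommGroup E] [NormedSpace ℂ E] {f : E → F} {c : ℂ} {y : E}
    (hf : ∀ z, f (c • z) = f z) (hd : DifferentiableAt ℝ f (c • y)) (u : E) :
    fderiv ℝ f (c • y) (c • u) = fderiv ℝ f y u := by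
  have h1 : HasFDerivAt (fun z : E => c • z) (c • ContinuousLinearMap.id ℝ E) y :=
    (hasFDerivAt_id (𝕜 := ℝ) y).const_smul c
  have h2 := hd.hasFDerivAt.comp y h1
  have h3 : f ∘ (fun z : E => c • z) = f := funext hf
  rw [h3] at h2
  rw [h2.fderiv]
  rfl

end ActionAlgebroid

/-! ### The action algebroid over the projective space -/

section TangentBundle

/-- A map to the tangent bundle of a normed space is smooth when its two components are. -/
theorem contMDiffAt_tangentBundle_mk {E EM : Type*} [NormedAddCommGroup E] [NormedSpace ℝ E]
    [NormedAddCommGroup EM] [NormedSpace ℝ EM] {HM : Type*} [TopologicalSpace HM]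
    {I : ModelWithCorners ℝ EM HM} {M : Type*} [TopologicalSpace M] [ChartedSpace HM M]
    {f X : M → E} {p : M} (hf : ContMDiffAt I 𝓘(ℝ, E) ∞ f p) (hX : ContMDiffAt I 𝓘(ℝ, E) ∞ X p) :
    ContMDiffAt I 𝓘(ℝ, E).tangent ∞ (fun q => (⟨f q, X q⟩ : TangentBundle 𝓘(ℝ, E) E)) p := by
  refine Bundle.contMDiffAt_totalSpace.mpr ⟨hf, ?_⟩
  simp only [trivializationAt_model_space_apply]
  exact hX

theorem contDiff_affineCoord_action {H : Type*} [NormedAddCommGroup H] [InnerProductSpace ℂ H]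
    {n : ℕ} [Fact (finrank ℂ H = n + 1)] {𝔤 : Type*} [NormedAddCommGroup 𝔤] [NormedSpace ℝ 𝔤]
    (ρ : 𝔤 →L[ℝ] H →L[ℝ] H) (φ : Metric.sphere (0 : H) 1) :
    ContDiff ℝ ∞ (fun q : EuclideanSpace ℂ (Fin n) × 𝔤 =>
      fderiv ℝ (affineCoord n φ) (affineInv n φ q.1) (ρ q.2 (affineInv n φ q.1))) := by
  refine contDiff_iff_contDiffAt.mpr fun q => ?_
  have h1 : ContDiffAt ℝ ∞ (affineCoord n φ) (affineInv n φ q.1) :=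
    (contDiffOn_real_affineCoord φ).contDiffAt ((isOpen_inner_ne_zero (φ : H)).mem_nhds (by
      rw [Set.mem_ofPred_eq, inner_affineInv]; exact one_ne_zero))
  have h3 : ContDiffAt ℝ ∞ (fun q : EuclideanSpace ℂ (Fin n) × 𝔤 => affineInv n φ q.1) q :=
    ((contDiff_real_affineInv φ).comp contDiff_fst).contDiffAt
  exact (ContDiffAt.comp q (h1.fderiv_right (m := ∞) (by simp)) h3).clm_apply
    ((ρ.contDiff.comp contDiff_snd).contDiffAt.clm_apply h3)

end TangentBundle

section ProjectiveAction

open VectorField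

variable {H : Type*} [NormedAddCommGroup H] [InnerProductSpace ℂ H] [Nontrivial H] {n : ℕ}
  [Fact (finrank ℂ H = n + 1)] {F : Type*} [NormedAddCommGroup F] [NormedSpace ℝ F]
  {𝔤 : Type*} [NormedAddCommGroup 𝔤] [NormedSpace ℝ 𝔤]
  {B : 𝔤 →L[ℝ] 𝔤 →L[ℝ] 𝔤} {ρ : 𝔤 →L[ℝ] H →L[ℝ] H}

theorem contDiffAt_comp_ray {g : ℙ ℂ H → F}
    (hg : ContMDiff 𝓘(ℝ, EuclideanSpace ℂ (Fin n)) 𝓘(ℝ, F) ∞ g) {ψ : H} (h : ψ ≠ 0) :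
    ContDiffAt ℝ ∞ (fun y => g (ray y)) ψ :=
  (hg.contMDiffAt.comp ψ (contMDiffAt_ray n h)).contDiffAt

theorem differentiableAt_comp_ray {g : ℙ ℂ H → F}
    (hg : ContMDiff 𝓘(ℝ, EuclideanSpace ℂ (Fin n)) 𝓘(ℝ, F) ∞ g) {ψ : H} (h : ψ ≠ 0) :
    DifferentiableAt ℝ (fun y => g (ray y)) ψ :=
  (contDiffAt_comp_ray hg h).differentiableAt (by simp)

theorem fderiv_comp_ray {g : ℙ ℂ H → F}
    (hg : ContMDiff 𝓘(ℝ, EuclideanSpace ℂ (Fin n)) 𝓘(ℝ, F) ∞ g) {ψ : H} (h : ψ ≠ 0) (u : H) :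
    fderiv ℝ (fun y => g (ray y)) ψ u =
      mfderiv 𝓘(ℝ, EuclideanSpace ℂ (Fin n)) 𝓘(ℝ, F) g (ray ψ) (rayDeriv n ψ u) := by
  refine Eq.trans ?_ (mfderiv_comp_ray h (hg.mdifferentiable (by simp) _) u).symm
  rw [mfderiv_eq_fderiv]
  rfl

/-- The bracket of the action algebroid over the projective space: `𝔤`-valued functions of the
rays are multiplied as functions of the vectors, and the result is evaluated at the unit vector
chosen on the ray. -/
def projBracket (B : 𝔤 →L[ℝ] 𝔤 →L[ℝ] 𝔤) (ρ : 𝔤 →L[ℝ] H →L[ℝ] H) (a b : ℙ ℂ H → 𝔤)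
    (x : ℙ ℂ H) : 𝔤 :=
  actionBracket B ρ (fun y => a (ray y)) (fun y => b (ray y)) (unitRep x : H)

theorem actionField_comp_ray_smul (hc : ∀ A (c : ℂ) v, ρ A (c • v) = c • ρ A v) (a : ℙ ℂ H → 𝔤)
    {c : ℂ} (h : c ≠ 0) (y : H) :
    actionField ρ (fun y => a (ray y)) (c • y) = c • actionField ρ (fun y => a (ray y)) y := by
  simp only [actionField, ray_smul h, hc]

/-- The bracket of functions of the rays is again a function of the rays. -/
theorem projBracket_ray (hc : ∀ A (c : ℂ) v, ρ A (c • v) = c • ρ A v) {a b : ℙ ℂ H → 𝔤}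
    (ha : ContMDiff 𝓘(ℝ, EuclideanSpace ℂ (Fin n)) 𝓘(ℝ, 𝔤) ∞ a)
    (hb : ContMDiff 𝓘(ℝ, EuclideanSpace ℂ (Fin n)) 𝓘(ℝ, 𝔤) ∞ b) {ψ : H} (h : ψ ≠ 0) :
    projBracket B ρ a b (ray ψ) =
      actionBracket B ρ (fun y => a (ray y)) (fun y => b (ray y)) ψ := by
  obtain ⟨c, h0, e⟩ := exists_eq_smul_unitRep h
  set φ : H := (unitRep (ray ψ) : H)
  have hφ : φ ≠ 0 := unitRep_ne_zero (ray ψ)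
  have hs : ∀ (g : ℙ ℂ H → 𝔤) (z : H), g (ray (c • z)) = g (ray z) := fun g z => by
    rw [ray_smul h0]
  have key : actionBracket B ρ (fun y => a (ray y)) (fun y => b (ray y)) (c • φ) =
      actionBracket B ρ (fun y => a (ray y)) (fun y => b (ray y)) φ := by
    rw [actionBracket, actionBracket, actionField_comp_ray_smul hc a h0,
      actionField_comp_ray_smul hc b h0,
      fderiv_smul_of_homogeneous (hs a) (differentiableAt_comp_ray ha (smul_ne_zero h0 hφ)),
      fderiv_smul_of_homogeneous (hs b) (differentiableAt_comp_ray hb (smul_ne_zero h0 hφ)),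
      ray_smul h0]
  rw [e, key, ← e]
  rfl

theorem projBracket_ray_eventuallyEq (hc : ∀ A (c : ℂ) v, ρ A (c • v) = c • ρ A v)
    {a b : ℙ ℂ H → 𝔤} (ha : ContMDiff 𝓘(ℝ, EuclideanSpace ℂ (Fin n)) 𝓘(ℝ, 𝔤) ∞ a)
    (hb : ContMDiff 𝓘(ℝ, EuclideanSpace ℂ (Fin n)) 𝓘(ℝ, 𝔤) ∞ b) {ψ : H} (h : ψ ≠ 0) :
    (fun y => projBracket B ρ a b (ray y)) =ᶠ[nhds ψ]
      actionBracket B ρ (fun y => a (ray y)) (fun y => b (ray y)) := by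
  filter_upwards [isOpen_ne.mem_nhds h] with y hy using projBracket_ray hc ha hb hy

theorem contMDiff_projBracket (hc : ∀ A (c : ℂ) v, ρ A (c • v) = c • ρ A v)
    {a b : ℙ ℂ H → 𝔤} (ha : ContMDiff 𝓘(ℝ, EuclideanSpace ℂ (Fin n)) 𝓘(ℝ, 𝔤) ∞ a)
    (hb : ContMDiff 𝓘(ℝ, EuclideanSpace ℂ (Fin n)) 𝓘(ℝ, 𝔤) ∞ b) :
    ContMDiff 𝓘(ℝ, EuclideanSpace ℂ (Fin n)) 𝓘(ℝ, 𝔤) ∞ (projBracket B ρ a b) :=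
  contMDiff_of_comp_ray fun _ h =>
    ((contDiffAt_actionBracket (contDiffAt_comp_ray ha h)
      (contDiffAt_comp_ray hb h)).congr_of_eventuallyEq
        (projBracket_ray_eventuallyEq hc ha hb h)).contMDiffAt

theorem projBracket_antisymm (hB : ∀ a b, B a b = - B b a) (a b : ℙ ℂ H → 𝔤) (x : ℙ ℂ H) :
    projBracket B ρ a b x = - projBracket B ρ b a x :=
  actionBracket_antisymm hB _ _ _

theorem projBracket_jacobi (hc : ∀ A (c : ℂ) v, ρ A (c • v) = c • ρ A v)
    (hB : ∀ a b, B a b = - B b a)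
    (hJ : ∀ a b c, B a (B b c) + B b (B c a) + B c (B a b) = 0)
    (hρ : ∀ a b v, ρ (B a b) v = ρ b (ρ a v) - ρ a (ρ b v)) {a b c : ℙ ℂ H → 𝔤}
    (ha : ContMDiff 𝓘(ℝ, EuclideanSpace ℂ (Fin n)) 𝓘(ℝ, 𝔤) ∞ a)
    (hb : ContMDiff 𝓘(ℝ, EuclideanSpace ℂ (Fin n)) 𝓘(ℝ, 𝔤) ∞ b)
    (hc' : ContMDiff 𝓘(ℝ, EuclideanSpace ℂ (Fin n)) 𝓘(ℝ, 𝔤) ∞ c) (x : ℙ ℂ H) :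
    projBracket B ρ a (projBracket B ρ b c) x + projBracket B ρ b (projBracket B ρ c a) x +
      projBracket B ρ c (projBracket B ρ a b) x = 0 := by
  have h := unitRep_ne_zero x
  rw [projBracket, actionBracket_congr_right (projBracket_ray_eventuallyEq hc hb hc' h),
    projBracket, actionBracket_congr_right (projBracket_ray_eventuallyEq hc hc' ha h),
    projBracket, actionBracket_congr_right (projBracket_ray_eventuallyEq hc ha hb h)]
  exact actionBracket_jacobi hB hJ hρ (contDiffAt_comp_ray ha h) (contDiffAt_comp_ray hb h)
    (contDiffAt_comp_ray hc' h)

theorem projBracket_add {a b c : ℙ ℂ H → 𝔤}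
    (hb : ContMDiff 𝓘(ℝ, EuclideanSpace ℂ (Fin n)) 𝓘(ℝ, 𝔤) ∞ b)
    (hc : ContMDiff 𝓘(ℝ, EuclideanSpace ℂ (Fin n)) 𝓘(ℝ, 𝔤) ∞ c) (x : ℙ ℂ H) :
    projBracket B ρ a (fun x => b x + c x) x =
      projBracket B ρ a b x + projBracket B ρ a c x :=
  actionBracket_add (differentiableAt_comp_ray hb (unitRep_ne_zero x))
    (differentiableAt_comp_ray hc (unitRep_ne_zero x))

theorem projBracket_const_smul (r : ℝ) {a b : ℙ ℂ H → 𝔤}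
    (hb : ContMDiff 𝓘(ℝ, EuclideanSpace ℂ (Fin n)) 𝓘(ℝ, 𝔤) ∞ b) (x : ℙ ℂ H) :
    projBracket B ρ a (fun x => r • b x) x = r • projBracket B ρ a b x := by
  have h := actionBracket_smul (B := B) (ρ := ρ) (a := fun y => a (ray y))
    (differentiableAt_const r) (differentiableAt_comp_ray hb (unitRep_ne_zero x))
  rw [fderiv_fun_const] at h
  refine Eq.trans h ?_
  simp only [Pi.zero_apply, zero_apply, zero_smul, zero_add]
  rfl

theorem projBracket_const (A A' : 𝔤) (x : ℙ ℂ H) :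
    projBracket B ρ (fun _ => A) (fun _ => A') x = B A A' := by
  simp [projBracket, actionBracket]

/-- A fibrewise map from `𝔤` to the tangent spaces is the infinitesimal action when the tangent
vector of `A` at `[ψ]` is the velocity of the ray of `ψ` moving with velocity `ρ A ψ`. -/
def IsInfinitesimalAction (n : ℕ) [Fact (finrank ℂ H = n + 1)] (ρ : 𝔤 →L[ℝ] H →L[ℝ] H)
    (anchor : ∀ x : ℙ ℂ H, 𝔤 → TangentSpace 𝓘(ℝ, EuclideanSpace ℂ (Fin n)) x) : Prop :=
  ∀ (A : 𝔤) (ψ : H), ψ ≠ 0 → anchor (ray ψ) A = rayDeriv n ψ (ρ A ψ)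

variable {anchor : ∀ x : ℙ ℂ H, 𝔤 → TangentSpace 𝓘(ℝ, EuclideanSpace ℂ (Fin n)) x}

/-- The Leibniz rule. -/
theorem projBracket_smul (han : IsInfinitesimalAction n ρ anchor) {a b : ℙ ℂ H → 𝔤} {f : ℙ ℂ H → ℝ}
    (hb : ContMDiff 𝓘(ℝ, EuclideanSpace ℂ (Fin n)) 𝓘(ℝ, 𝔤) ∞ b)
    (hf : ContMDiff 𝓘(ℝ, EuclideanSpace ℂ (Fin n)) 𝓘(ℝ, ℝ) ∞ f) (x : ℙ ℂ H) :
    projBracket B ρ a (fun x => f x • b x) x =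
      dirDeriv 𝓘(ℝ, EuclideanSpace ℂ (Fin n)) f x (anchor x (a x)) • b x +
        f x • projBracket B ρ a b x := by
  obtain ⟨ψ, h, hx⟩ : ∃ ψ : H, ψ ≠ 0 ∧ (unitRep x : H) = ψ := ⟨_, unitRep_ne_zero x, rfl⟩
  obtain rfl : ray ψ = x := by rw [← hx, ray_unitRep]
  have h1 := actionBracket_smul (B := B) (ρ := ρ) (a := fun y => a (ray y))
    (differentiableAt_comp_ray hf h) (differentiableAt_comp_ray hb h)
  rw [fderiv_comp_ray hf h] at h1
  rw [projBracket, projBracket, hx, han _ _ h]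
  exact h1

/-- A velocity `u` at the point `φ + w` of the affine hyperplane moves the ray in the direction
whose coordinate expression in the affine chart of `φ` is the derivative of the affine coordinate. -/
theorem mfderiv_affineChart_symm_fderiv (φ : Metric.sphere (0 : H) 1)
    (w : EuclideanSpace ℂ (Fin n)) (u : H) :
    (mfderiv 𝓘(ℝ, EuclideanSpace ℂ (Fin n)) 𝓘(ℝ, EuclideanSpace ℂ (Fin n))
      (affineChart n φ).symm w (fderiv ℝ (affineCoord n φ) (affineInv n φ w) u) :
        EuclideanSpace ℂ (Fin n)) = rayDeriv n (affineInv n φ w) u := by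
  have h0 := affineInv_ne_zero (n := n) φ w
  have hi := inner_affineInv (n := n) φ w
  rw [mfderiv_affineChart_symm, fderiv_affineCoord φ (by rw [hi]; exact one_ne_zero),
    LinearIsometryEquiv.symm_apply_apply, hi, inv_one, one_smul, one_pow, inv_one, one_mul]
  set ψ := affineInv n φ w
  have hm : u - ⟪(φ : H), u⟫_ℂ • ψ ∈ (ℂ ∙ (φ : H))ᗮ := by
    rw [Submodule.mem_orthogonal_singleton_iff_inner_right, inner_sub_right, inner_smul_right, hi,
      mul_one, sub_self]
  have hp := congrArg Subtype.val (Submodule.orthogonalProjectionOnto_mem_subspace_eq_self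
    (K := (ℂ ∙ (φ : H))ᗮ) ⟨_, hm⟩)
  have hz : rayDeriv n ψ (⟪(φ : H), u⟫_ℂ • ψ) = 0 := (rayDeriv_eq_zero_iff h0 _).mpr ⟨_, rfl⟩
  refine (congrArg (fun y => (rayDeriv n ψ y : EuclideanSpace ℂ (Fin n))) hp).trans ?_
  refine (map_sub (rayDeriv n ψ) _ _).trans ?_
  rw [hz, sub_zero]

/-- The coordinate expression in the affine chart of `φ` of the infinitesimal action of the
`𝔤`-valued function `a`. -/
def affineField (ρ : 𝔤 →L[ℝ] H →L[ℝ] H) (φ : Metric.sphere (0 : H) 1) (a : ℙ ℂ H → 𝔤)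
    (w : EuclideanSpace ℂ (Fin n)) : EuclideanSpace ℂ (Fin n) :=
  fderiv ℝ (affineCoord n φ) (affineInv n φ w)
    (actionField ρ (fun y => a (ray y)) (affineInv n φ w))

theorem contDiffAt_affineField (φ : Metric.sphere (0 : H) 1) {a : ℙ ℂ H → 𝔤}
    (ha : ContMDiff 𝓘(ℝ, EuclideanSpace ℂ (Fin n)) 𝓘(ℝ, 𝔤) ∞ a)
    (w : EuclideanSpace ℂ (Fin n)) : ContDiffAt ℝ ∞ (affineField ρ φ a) w := by
  have h1 : ContDiffAt ℝ ∞ (affineCoord n φ) (affineInv n φ w) :=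
    (contDiffOn_real_affineCoord φ).contDiffAt ((isOpen_inner_ne_zero (φ : H)).mem_nhds (by
      rw [Set.mem_ofPred_eq, inner_affineInv]; exact one_ne_zero))
  exact ContDiffAt.comp w ((h1.fderiv_right (m := ∞) (by simp)).clm_apply
    (contDiffAt_actionField (contDiffAt_comp_ray ha (affineInv_ne_zero φ w))))
      (contDiff_real_affineInv φ).contDiffAt

/-- The affine coordinate relates the vector field generated by `a` on the Hilbert space to its
coordinate expression. -/
theorem fderiv_affineCoord_actionField (hc : ∀ A (c : ℂ) v, ρ A (c • v) = c • ρ A v)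
    (φ : Metric.sphere (0 : H) 1) (a : ℙ ℂ H → 𝔤) {y : H} (hy : ⟪(φ : H), y⟫_ℂ ≠ 0) :
    fderiv ℝ (affineCoord n φ) y (actionField ρ (fun y => a (ray y)) y) =
      affineField ρ φ a (affineCoord n φ y) := by
  have h0 := inv_ne_zero hy
  have h1 : ⟪(φ : H), (⟪(φ : H), y⟫_ℂ)⁻¹ • y⟫_ℂ ≠ 0 := by
    rw [inner_smul_right, inv_mul_cancel₀ hy]; exact one_ne_zero
  rw [affineField, affineInv_affineCoord φ hy, actionField_comp_ray_smul hc a h0,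
    fderiv_affineCoord φ hy, fderiv_affineCoord φ h1]
  simp only [inner_smul_right, smul_smul]
  congr 4 <;> field_simp

/-- The pullback through the preferred chart by which the Lie bracket on the manifold is defined is
the coordinate expression `affineField`. -/
theorem mpullbackWithin_affineChart (han : IsInfinitesimalAction n ρ anchor) (x : ℙ ℂ H)
    (a : ℙ ℂ H → 𝔤) :
    mpullbackWithin 𝓘(ℝ, EuclideanSpace ℂ (Fin n)) 𝓘(ℝ, EuclideanSpace ℂ (Fin n))
      (extChartAt 𝓘(ℝ, EuclideanSpace ℂ (Fin n)) x).symm (fun y => anchor y (a y))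
      (Set.range 𝓘(ℝ, EuclideanSpace ℂ (Fin n))) = affineField ρ (unitRep x) a := by
  funext w
  have hw : w ∈ (extChartAt 𝓘(ℝ, EuclideanSpace ℂ (Fin n)) x).target := by
    simp only [extChartAt, mfld_simps]
    exact Set.mem_univ w
  have hi := isInvertible_mfderivWithin_extChartAt_symm hw
  rw [mpullbackWithin_apply]
  refine (hi.inverse_apply_eq).mpr ?_
  have e : mfderivWithin 𝓘(ℝ, EuclideanSpace ℂ (Fin n)) 𝓘(ℝ, EuclideanSpace ℂ (Fin n))
      (extChartAt 𝓘(ℝ, EuclideanSpace ℂ (Fin n)) x).symm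
      (Set.range 𝓘(ℝ, EuclideanSpace ℂ (Fin n))) w =
      mfderiv 𝓘(ℝ, EuclideanSpace ℂ (Fin n)) 𝓘(ℝ, EuclideanSpace ℂ (Fin n))
        (affineChart n (unitRep x)).symm w := by
    simp only [mfld_simps, mfderivWithin_univ]
    rfl
  rw [e]
  refine Eq.trans ?_ (mfderiv_affineChart_symm_fderiv (unitRep x) w _).symm
  refine Eq.trans ?_ (han _ _ (affineInv_ne_zero (n := n) (unitRep x) w))
  have e2 : (extChartAt 𝓘(ℝ, EuclideanSpace ℂ (Fin n)) x).symm w =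
      ray (affineInv n (unitRep x) w) := congrFun (coe_affineChart_symm (unitRep x)) w
  rw [e2]

/-- The infinitesimal action takes the bracket of the action algebroid to the Lie bracket of
vector fields. -/
theorem anchor_projBracket (hc : ∀ A (c : ℂ) v, ρ A (c • v) = c • ρ A v)
    (hρ : ∀ a b v, ρ (B a b) v = ρ b (ρ a v) - ρ a (ρ b v))
    (han : IsInfinitesimalAction n ρ anchor) {a b : ℙ ℂ H → 𝔤}
    (ha : ContMDiff 𝓘(ℝ, EuclideanSpace ℂ (Fin n)) 𝓘(ℝ, 𝔤) ∞ a)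
    (hb : ContMDiff 𝓘(ℝ, EuclideanSpace ℂ (Fin n)) 𝓘(ℝ, 𝔤) ∞ b) (x : ℙ ℂ H) :
    anchor x (projBracket B ρ a b x) =
      mlieBracket 𝓘(ℝ, EuclideanSpace ℂ (Fin n)) (fun y => anchor y (a y))
        (fun y => anchor y (b y)) x := by
  have hφ := inner_self_unit (unitRep x)
  have hφ0 : ⟪(unitRep x : H), (unitRep x : H)⟫_ℂ ≠ 0 := by rw [hφ]; exact one_ne_zero
  have h0 := unitRep_ne_zero x
  have hn := (isOpen_inner_ne_zero (unitRep x : H)).mem_nhds hφ0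
  have h1 := lieBracket_of_related
    ((contDiffOn_real_affineCoord (n := n) (unitRep x)).contDiffAt hn)
    ((contDiffAt_actionField (ρ := ρ) (contDiffAt_comp_ray ha h0)).differentiableAt (by simp))
    ((contDiffAt_actionField (ρ := ρ) (contDiffAt_comp_ray hb h0)).differentiableAt (by simp))
    ((contDiffAt_affineField (ρ := ρ) (unitRep x) ha _).differentiableAt (by simp))
    ((contDiffAt_affineField (ρ := ρ) (unitRep x) hb _).differentiableAt (by simp))
    (by filter_upwards [hn] with y hy using fderiv_affineCoord_actionField hc _ a hy)
    (by filter_upwards [hn] with y hy using fderiv_affineCoord_actionField hc _ b hy)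
  rw [lieBracket_actionField hρ (differentiableAt_comp_ray ha h0)
    (differentiableAt_comp_ray hb h0)] at h1
  have hx : extChartAt 𝓘(ℝ, EuclideanSpace ℂ (Fin n)) x x =
      affineCoord n (unitRep x) (unitRep x) := by
    have := affineChart_ray (n := n) (unitRep x) h0
    rw [ray_unitRep] at this
    exact this
  have h2 : mlieBracket 𝓘(ℝ, EuclideanSpace ℂ (Fin n)) (fun y => anchor y (a y))
        (fun y => anchor y (b y)) x = lieBracket ℝ (affineField ρ (unitRep x) a)
          (affineField ρ (unitRep x) b) (affineCoord n (unitRep x) (unitRep x)) := by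
    have h5 : (extChartAt 𝓘(ℝ, EuclideanSpace ℂ (Fin n)) x).symm ⁻¹' Set.univ ∩
        Set.range 𝓘(ℝ, EuclideanSpace ℂ (Fin n)) = Set.univ := by
      simp only [mfld_simps]
    rw [mlieBracket, mlieBracketWithin_apply, mpullbackWithin_affineChart han,
      mpullbackWithin_affineChart han, mfderiv_extChartAt_self, h5, lieBracketWithin_univ, hx]
    exact congrArg (fun T : EuclideanSpace ℂ (Fin n) →L[ℝ] EuclideanSpace ℂ (Fin n) => T _)
      (ContinuousLinearMap.inverse_id (R := ℝ) (M := EuclideanSpace ℂ (Fin n)))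
  rw [h2, h1]
  have h3 := han (projBracket B ρ a b x) (unitRep x) h0
  have h4 := rayDeriv_apply (n := n) h0 (ρ (projBracket B ρ a b x) (unitRep x))
  rw [h4] at h3
  have h6 : (anchor (ray (unitRep x : H)) (projBracket B ρ a b x) : EuclideanSpace ℂ (Fin n)) =
      anchor x (projBracket B ρ a b x) := by rw [ray_unitRep]
  refine h6.symm.trans (h3.trans ?_)
  rw [ray_unitRep]
  rfl

/-- The inverse of the affine chart maps the coordinate expression of the infinitesimal action of
`A` to the infinitesimal action. -/
theorem tangentMap_affineChart_symm (han : IsInfinitesimalAction n ρ anchor)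
    (φ : Metric.sphere (0 : H) 1) (A : 𝔤) (w : EuclideanSpace ℂ (Fin n)) :
    tangentMap 𝓘(ℝ, EuclideanSpace ℂ (Fin n)) 𝓘(ℝ, EuclideanSpace ℂ (Fin n))
      (affineChart n φ).symm
      (⟨w, fderiv ℝ (affineCoord n φ) (affineInv n φ w) (ρ A (affineInv n φ w))⟩ :
            TangentBundle 𝓘(ℝ, EuclideanSpace ℂ (Fin n)) (EuclideanSpace ℂ (Fin n))) =
      ⟨(affineChart n φ).symm w, anchor ((affineChart n φ).symm w) A⟩ := by
  rw [tangentMap]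
  refine congrArg (fun v : EuclideanSpace ℂ (Fin n) =>
    (⟨(affineChart n φ).symm w, v⟩ : TangentBundle 𝓘(ℝ, EuclideanSpace ℂ (Fin n)) (ℙ ℂ H))) ?_
  refine (mfderiv_affineChart_symm_fderiv φ w _).trans ?_
  refine (han _ _ (affineInv_ne_zero (n := n) φ w)).symm.trans ?_
  have e2 : (affineChart n φ).symm w = ray (affineInv n φ w) :=
    congrFun (coe_affineChart_symm φ) w
  rw [e2]

/-- The infinitesimal action is smooth, because in an affine chart it is the derivative of the
affine coordinate along the linear vector fields `ρ A`. -/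
theorem contMDiff_anchor (han : IsInfinitesimalAction n ρ anchor) :
    ContMDiff (𝓘(ℝ, EuclideanSpace ℂ (Fin n)).prod 𝓘(ℝ, 𝔤))
      𝓘(ℝ, EuclideanSpace ℂ (Fin n)).tangent ∞
      (fun p : Bundle.TotalSpace 𝔤 (Bundle.Trivial (ℙ ℂ H) 𝔤) =>
        (⟨p.1, anchor p.1 p.2⟩ :
          TangentBundle 𝓘(ℝ, EuclideanSpace ℂ (Fin n)) (ℙ ℂ H))) := by
  intro p
  have hp := Bundle.contMDiffAt_totalSpace.mp
    (contMDiffAt_id (I := 𝓘(ℝ, EuclideanSpace ℂ (Fin n)).prod 𝓘(ℝ, 𝔤)) (n := ∞) (x := p))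
  obtain ⟨φ, hφ⟩ : ∃ φ : Metric.sphere (0 : H) 1, p.1 ∈ (affineChart n φ).source :=
    ⟨unitRep p.1, mem_chart_source (EuclideanSpace ℂ (Fin n)) p.1⟩
  have hs : (affineChart n φ).source ∈ nhds p.1 := (affineChart n φ).open_source.mem_nhds hφ
  have hw : ContMDiffAt (𝓘(ℝ, EuclideanSpace ℂ (Fin n)).prod 𝓘(ℝ, 𝔤))
      𝓘(ℝ, EuclideanSpace ℂ (Fin n)) ∞
      (fun p : Bundle.TotalSpace 𝔤 (Bundle.Trivial (ℙ ℂ H) 𝔤) => affineChart n φ p.1) p :=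
    (contMDiffAt_of_mem_maximalAtlas (affineChart_mem_maximalAtlas φ) hφ).comp p hp.1
  have h2 : ContMDiffAt (𝓘(ℝ, EuclideanSpace ℂ (Fin n)).prod 𝓘(ℝ, 𝔤)) 𝓘(ℝ, 𝔤) ∞
      (fun p : Bundle.TotalSpace 𝔤 (Bundle.Trivial (ℙ ℂ H) 𝔤) => p.2) p := hp.2
  have hT := (contMDiff_affineChart_symm (n := n) φ).contMDiff_tangentMap (m := ∞) (by simp)
  have hq := contMDiffAt_tangentBundle_mk hw
    ((contDiff_affineCoord_action (n := n) ρ φ).contMDiff.contMDiffAt.comp p (hw.prodMk_space h2))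
  refine ((hT.contMDiffAt.comp p hq).congr_of_eventuallyEq ?_)
  filter_upwards [hp.1.continuousAt.preimage_mem_nhds hs] with q hq
  refine Eq.trans ?_ (tangentMap_affineChart_symm han φ q.2 (affineChart n φ q.1)).symm
  have hl : (affineChart n φ).symm (affineChart n φ q.1) = q.1 := (affineChart n φ).left_inv hq
  rw [hl]

end ProjectiveAction

/-! ### The Lie algebra of observables -/

section Abbreviations

/-- Continuous bilinear operations on a normed space. The abbreviation fixes the topology and the
module structure to those derived from the norm, which is what the general lemmas expect. -/
abbrev ContinuousBracket (𝔤 : Type*) [NormedAddCommGroup 𝔤] [NormedSpace ℝ 𝔤] :=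
  𝔤 →L[ℝ] 𝔤 →L[ℝ] 𝔤

/-- Continuous linear families, indexed by `𝔤`, of continuous linear operators, with structures
derived from the norms as in `ContinuousBracket`. -/
abbrev LinearAction (𝔤 H : Type*) [NormedAddCommGroup 𝔤] [NormedSpace ℝ 𝔤] [NormedAddCommGroup H]
    [NormedSpace ℝ H] :=
  𝔤 →L[ℝ] H →L[ℝ] H

end Abbreviations

section Observables

variable {H : Type*} [NormedAddCommGroup H] [InnerProductSpace ℂ H] [CompleteSpace H]

/-- The real vector space structure underlying the normed space of observables. It agrees with the
one that instance search finds and is recorded to shorten that search. -/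
abbrev observableModule : Module ℝ (Observable H) := NormedSpace.toModule

attribute [local instance] observableModule

theorem observableContinuousSMul : ContinuousSMul ℝ (Observable H) := IsBoundedSMul.continuousSMul

attribute [local instance] observableContinuousSMul

theorem coe_observableBracket (A B : Observable H) :
    (observableBracket A B : H →L[ℂ] H) =
      (-Complex.I) • ((A : H →L[ℂ] H) * B - (B : H →L[ℂ] H) * A) := rfl

theorem coe_observable_smul (r : ℝ) (A : Observable H) :
    ((r • A : Observable H) : H →L[ℂ] H) = r • (A : H →L[ℂ] H) := rfl

theorem observableBracket_antisymm (A B : Observable H) :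
    observableBracket A B = -observableBracket B A :=
  Subtype.ext (by
    rw [AddSubgroup.coe_neg, coe_observableBracket, coe_observableBracket, ← smul_neg, neg_sub])

theorem observableBracket_jacobi (A B C : Observable H) :
    observableBracket A (observableBracket B C) + observableBracket B (observableBracket C A) +
      observableBracket C (observableBracket A B) = 0 := by
  refine Subtype.ext ?_
  rw [AddSubgroup.coe_add, AddSubgroup.coe_add, AddSubgroup.coe_zero]
  simp only [coe_observableBracket, smul_mul_assoc, mul_smul_comm, mul_sub, sub_mul, mul_assoc]
  module

variable [FiniteDimensional ℂ H]

theorem finiteDimensional_observable : FiniteDimensional ℝ (Observable H) := by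
  have : FiniteDimensional ℝ (H →L[ℂ] H) := FiniteDimensional.complexToReal _
  exact inferInstanceAs (FiniteDimensional ℝ (selfAdjoint.submodule ℝ (H →L[ℂ] H)))

attribute [local instance] finiteDimensional_observable

/-- The Lie bracket of observables as a continuous bilinear map. -/
def bracketCLM : ContinuousBracket (Observable H) :=
  LinearMap.toContinuousBilinearMap (LinearMap.mk₂ ℝ observableBracket
    (fun A A' B => Subtype.ext (by
      simp only [coe_observableBracket, AddSubgroup.coe_add, add_mul, mul_add]
      module))
    (fun r A B => Subtype.ext (by
      simp only [coe_observableBracket, coe_observable_smul, smul_mul_assoc, mul_smul_comm]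
      module))
    (fun A B B' => Subtype.ext (by
      simp only [coe_observableBracket, AddSubgroup.coe_add, add_mul, mul_add]
      module))
    (fun r A B => Subtype.ext (by
      simp only [coe_observableBracket, coe_observable_smul, smul_mul_assoc, mul_smul_comm]
      module)))

theorem bracketCLM_apply (A B : Observable H) : bracketCLM A B = observableBracket A B := rfl

/-- The action `A ↦ i A` of the observables on the Hilbert space. -/
def evolutionCLM : LinearAction (Observable H) H :=
  LinearMap.toContinuousLinearMap
    { toFun := fun A => (Complex.I • (A : H →L[ℂ] H)).restrictScalars ℝ
      map_add' := fun A B => by ext; simp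
      map_smul' := fun r A => by
        ext v
        simp [smul_comm r Complex.I] }

theorem evolutionCLM_apply (A : Observable H) (v : H) :
    evolutionCLM A v = Complex.I • (A : H →L[ℂ] H) v := rfl

theorem bracketCLM_antisymm (A B : Observable H) : bracketCLM A B = -bracketCLM B A :=
  observableBracket_antisymm A B

/-- The action is an antihomomorphism for the bracket `(A B - B A) / i`. -/
theorem evolutionCLM_bracketCLM (A B : Observable H) (v : H) :
    evolutionCLM (bracketCLM A B) v =
      evolutionCLM B (evolutionCLM A v) - evolutionCLM A (evolutionCLM B v) := by
  simp only [evolutionCLM_apply, bracketCLM_apply, coe_observableBracket, map_smul, smul_apply,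
    sub_apply, mul_apply_eq_comp, smul_smul, mul_neg, Complex.I_mul_I]
  module

theorem evolutionCLM_smul (A : Observable H) (c : ℂ) (v : H) :
    evolutionCLM A (c • v) = c • evolutionCLM A v := by
  rw [evolutionCLM_apply, evolutionCLM_apply, map_smul, smul_comm]

end Observables

/-! ### The Lie algebroid of observables -/

section Frame

/-- A smooth map to a finite-dimensional space is a combination of constant maps with smooth
coefficients. -/
theorem exists_eq_sum_smul {E : Type*} [NormedAddCommGroup E] [NormedSpace ℝ E] {K : Type*}
    [TopologicalSpace K] {I : ModelWithCorners ℝ E K} {M : Type*} [TopologicalSpace M]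
    [ChartedSpace K M] {𝔤 : Type*} [NormedAddCommGroup 𝔤] [NormedSpace ℝ 𝔤]
    [FiniteDimensional ℝ 𝔤] {g : M → 𝔤} (hg : ContMDiff I 𝓘(ℝ, 𝔤) ∞ g) :
    ∃ (m : ℕ) (f : Fin m → C^∞⟮I, M; ℝ⟯) (A : Fin m → 𝔤), ∀ x, ∑ i, f i x • A i = g x := by
  let b := Module.finBasis ℝ 𝔤
  exact ⟨finrank ℝ 𝔤, fun i => ⟨fun x => LinearMap.toContinuousLinearMap (b.coord i) (g x),
    (LinearMap.toContinuousLinearMap (b.coord i)).contDiff.contMDiff.comp hg⟩, b,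
    fun x => b.sum_repr (g x)⟩

theorem contMDiff_smul_const {E : Type*} [NormedAddCommGroup E] [NormedSpace ℝ E] {K : Type*}
    [TopologicalSpace K] {I : ModelWithCorners ℝ E K} {M : Type*} [TopologicalSpace M]
    [ChartedSpace K M] {𝔤 : Type*} [NormedAddCommGroup 𝔤] [NormedSpace ℝ 𝔤]
    (f : C^∞⟮I, M; ℝ⟯) (A : 𝔤) : ContMDiff I 𝓘(ℝ, 𝔤) ∞ (fun x => f x • A) :=
  f.contMDiff.smul contMDiff_const

end Frame

section Sections

attribute [local instance] observableModule

variable {H : Type*} [NormedAddCommGroup H] [InnerProductSpace ℂ H] [CompleteSpace H]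
  {n : ℕ} [Fact (finrank ℂ H = n + 1)]

theorem contMDiff_section (v : ObservableSection n H) :
    ContMDiff 𝓘(ℝ, EuclideanSpace ℂ (Fin n)) 𝓘(ℝ, Observable H) ∞
      (fun x => (v x : Observable H)) :=
  fun x => (Bundle.contMDiffAt_section x).mp (v.contMDiff x)

/-- A smooth function on the projective space with values in the observables as a section of the
bundle of observables. -/
def sectionOfFun (g : ℙ ℂ H → Observable H)
    (hg : ContMDiff 𝓘(ℝ, EuclideanSpace ℂ (Fin n)) 𝓘(ℝ, Observable H) ∞ g) :
    ObservableSection n H where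
  toFun := g
  contMDiff_toFun := fun x => (Bundle.contMDiffAt_section x).mpr (hg x)

theorem section_sum_apply {ι : Type*} (s : Finset ι) (v : ι → ObservableSection n H) (x : ℙ ℂ H) :
    (∑ i ∈ s, v i) x = ∑ i ∈ s, (v i x : Observable H) := by
  have := congrFun (map_sum (ContMDiffSection.coeAddHom 𝓘(ℝ, EuclideanSpace ℂ (Fin n))
    (Observable H) ∞ (ObservableBundle H)) v s) x
  refine this.trans ?_
  rw [Finset.sum_apply]
  rfl

variable [FiniteDimensional ℂ H]

/-- The bracket of two sections of the bundle of observables: the pointwise bracket of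
observables, corrected by the derivatives along the Schrödinger vector fields. -/
def sectionBracket [Nontrivial H] (v w : ObservableSection n H) : ObservableSection n H :=
  sectionOfFun (projBracket bracketCLM evolutionCLM (fun x => v x) (fun x => w x))
    (contMDiff_projBracket evolutionCLM_smul (contMDiff_section v) (contMDiff_section w))

theorem sectionBracket_hamiltonianSection [Nontrivial H] (A B : Observable H) :
    sectionBracket (hamiltonianSection n A) (hamiltonianSection n B) =
      hamiltonianSection n (observableBracket A B) :=
  ContMDiffSection.ext fun x => projBracket_const A B x

/-- The anchor is the infinitesimal action of the observables, so that the theory of the action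
algebroid applies. -/
theorem isInfinitesimalAction_schrodingerAnchor [Nontrivial H] {ħ : ℝ} (hħ : ħ ≠ 0) :
    IsInfinitesimalAction n (evolutionCLM (H := H)) (fun x A => schrodingerAnchor n ħ x A) :=
  fun A _ h => schrodingerAnchor_ray hħ A h

theorem isLieAlgebroid_sectionBracket [Nontrivial H] {ħ : ℝ} (hħ : ħ ≠ 0) :
    IsLieAlgebroid (𝓘(ℝ, EuclideanSpace ℂ (Fin n))) (Observable H)
        (ObservableBundle H) sectionBracket (schrodingerAnchor n ħ) where
  anchor_smooth := contMDiff_anchor (isInfinitesimalAction_schrodingerAnchor hħ)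
  bracket_add u v w := ContMDiffSection.ext fun x =>
    projBracket_add (contMDiff_section v) (contMDiff_section w) x
  bracket_smul r u v := ContMDiffSection.ext fun x =>
    projBracket_const_smul r (contMDiff_section v) x
  bracket_antisymm u v := ContMDiffSection.ext fun x =>
    projBracket_antisymm bracketCLM_antisymm _ _ x
  jacobi u v w := ContMDiffSection.ext fun x =>
    projBracket_jacobi evolutionCLM_smul bracketCLM_antisymm observableBracket_jacobi
      evolutionCLM_bracketCLM (contMDiff_section u) (contMDiff_section v) (contMDiff_section w) x
  anchor_bracket u v x := anchor_projBracket evolutionCLM_smul evolutionCLM_bracketCLM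
    (isInfinitesimalAction_schrodingerAnchor hħ) (contMDiff_section u) (contMDiff_section v) x
  leibniz u v w f hw x := by
    have h := projBracket_smul (B := bracketCLM) (a := fun x => u x)
      (isInfinitesimalAction_schrodingerAnchor (H := H) hħ) (contMDiff_section v)
      f.contMDiff x
    exact (congrArg (fun b => projBracket bracketCLM evolutionCLM (fun x => u x) b x)
      (funext hw)).trans h

/-- The product of the constant section `A` and a smooth function. -/
def smulHamiltonianSection (f : C^∞⟮𝓘(ℝ, EuclideanSpace ℂ (Fin n)), ℙ ℂ H; ℝ⟯) (A : Observable H) :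
    ObservableSection n H :=
  sectionOfFun (fun x => f x • A) (contMDiff_smul_const f A)

/-- The constant sections of a basis of the observables form a frame of the bundle of
observables. -/
theorem exists_sum_smulHamiltonianSection (v : ObservableSection n H) :
    ∃ (m : ℕ) (f : Fin m → C^∞⟮𝓘(ℝ, EuclideanSpace ℂ (Fin n)), ℙ ℂ H; ℝ⟯)
      (A : Fin m → Observable H), v = ∑ i, smulHamiltonianSection (f i) (A i) := by
  have := finiteDimensional_observable (H := H)
  obtain ⟨m, f, A, h⟩ := exists_eq_sum_smul (contMDiff_section v)
  refine ⟨m, f, A, ContMDiffSection.ext fun x => ?_⟩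
  rw [section_sum_apply]
  exact (h x).symm

/-- A Lie algebroid bracket is determined by its values on constant sections in the second
argument, by the Leibniz rule. -/
theorem IsLieAlgebroid.bracket_ext_right
    {anchor : ∀ x : ℙ ℂ H, ObservableBundle H x →ₗ[ℝ]
      TangentSpace 𝓘(ℝ, EuclideanSpace ℂ (Fin n)) x}
    {β β' : ObservableSection n H → ObservableSection n H → ObservableSection n H}
    (h : IsLieAlgebroid 𝓘(ℝ, EuclideanSpace ℂ (Fin n)) (Observable H) (ObservableBundle H) β anchor)
    (h' : IsLieAlgebroid 𝓘(ℝ, EuclideanSpace ℂ (Fin n)) (Observable H) (ObservableBundle H) β'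
      anchor) {u : ObservableSection n H}
    (hu : ∀ A, β u (hamiltonianSection n A) = β' u (hamiltonianSection n A))
    (v : ObservableSection n H) : β u v = β' u v := by
  obtain ⟨m, f, A, rfl⟩ := exists_sum_smulHamiltonianSection v
  have e := map_sum (AddMonoidHom.mk' (β u) (h.bracket_add u))
    (fun i => smulHamiltonianSection (f i) (A i)) Finset.univ
  have e' := map_sum (AddMonoidHom.mk' (β' u) (h'.bracket_add u))
    (fun i => smulHamiltonianSection (f i) (A i)) Finset.univ
  refine e.trans (Eq.trans (Finset.sum_congr rfl fun i _ => ContMDiffSection.ext fun x => ?_)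
    e'.symm)
  refine (h.leibniz u (hamiltonianSection n (A i)) _ (f i) (fun _ => rfl) x).trans ?_
  rw [hu]
  exact (h'.leibniz u (hamiltonianSection n (A i)) _ (f i) (fun _ => rfl) x).symm

/-- A Lie algebroid bracket on the bundle of observables is determined by its values on the
constant sections. -/
theorem IsLieAlgebroid.bracket_ext
    {anchor : ∀ x : ℙ ℂ H, ObservableBundle H x →ₗ[ℝ]
      TangentSpace 𝓘(ℝ, EuclideanSpace ℂ (Fin n)) x}
    {β β' : ObservableSection n H → ObservableSection n H → ObservableSection n H}
    (h : IsLieAlgebroid 𝓘(ℝ, EuclideanSpace ℂ (Fin n)) (Observable H) (ObservableBundle H) β anchor)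
    (h' : IsLieAlgebroid 𝓘(ℝ, EuclideanSpace ℂ (Fin n)) (Observable H) (ObservableBundle H) β'
      anchor)
    (hA : ∀ A A', β (hamiltonianSection n A) (hamiltonianSection n A') =
      β' (hamiltonianSection n A) (hamiltonianSection n A')) : β = β' := by
  funext u v
  refine h.bracket_ext_right h' (fun A => ?_) v
  rw [h.bracket_antisymm, h'.bracket_antisymm]
  exact congrArg _ (h.bracket_ext_right h' (hA A) u)

end Sections

end

end QuantumPhase

theorem mainTheorem2 {H : Type*} [NormedAddCommGroup H] [InnerProductSpace ℂ H] [CompleteSpace H]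
    [FiniteDimensional ℂ H] [Nontrivial H] (n : ℕ) [Fact (finrank ℂ H = n + 1)]
    (ħ : ℝ) (hħ : 0 < ħ) :
    -- the quantum phase space: the principal bundle of unit vectors over their rays
    IsPrincipalBundle (𝓡 1) (𝓡 (2 * n + 1))
      (𝓘(ℝ, EuclideanSpace ℂ (Fin n)))
      (phaseAct : Circle → Metric.sphere (0 : H) 1 → Metric.sphere (0 : H) 1) phaseProj ∧
    -- the Kähler structure `g + i ω` of the projective space, induced by the Hermitian product
    IsKahlerMetric (M := ℙ ℂ H) (fubiniStudy n) ∧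
    (∀ ψ : H, ψ ≠ 0 → Function.Surjective (rayDeriv n ψ) ∧ ∀ u v : H,
      fubiniStudy n (ray ψ) (rayDeriv n ψ u) (rayDeriv n ψ v) =
        (⟪ψ, ψ⟫_ℂ * ⟪u, v⟫_ℂ - ⟪u, ψ⟫_ℂ * ⟪ψ, v⟫_ℂ) / ⟪ψ, ψ⟫_ℂ ^ 2) ∧
    -- the unitary group acts by automorphisms
    (∀ U : unitary (H →L[ℂ] H),
      (∀ ψ : H, ψ ≠ 0 → unitaryAct U (ray ψ) = ray ((U : H →L[ℂ] H) ψ)) ∧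
      ContMDiff (𝓘(ℝ, EuclideanSpace ℂ (Fin n)))
        (𝓘(ℝ, EuclideanSpace ℂ (Fin n))) ∞
        (unitaryAct U : ℙ ℂ H → ℙ ℂ H) ∧
      ∀ x u v, fubiniStudy n (unitaryAct U x)
        (mfderiv (𝓘(ℝ, EuclideanSpace ℂ (Fin n)))
          (𝓘(ℝ, EuclideanSpace ℂ (Fin n))) (unitaryAct U) x u)
        (mfderiv (𝓘(ℝ, EuclideanSpace ℂ (Fin n)))
          (𝓘(ℝ, EuclideanSpace ℂ (Fin n))) (unitaryAct U) x v) =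
        fubiniStudy n x u v) ∧
    -- the anchor is the Schrödinger equation and gives Hamiltonian vector fields
    (∀ (A : Observable H) (ψ : H), ψ ≠ 0 →
      schrodingerAnchor n ħ (ray ψ) A = rayDeriv n ψ (schrodingerVector ħ A ψ)) ∧
    (∀ (A : Observable H) (x : ℙ ℂ H)
      (u : TangentSpace (𝓘(ℝ, EuclideanSpace ℂ (Fin n))) x),
      (fubiniStudy n x (schrodingerAnchor n ħ x A) u).im =
        -(1 / 2) * dirDeriv (𝓘(ℝ, EuclideanSpace ℂ (Fin n)))
          (expectation A) x u) ∧
    -- it generates the unitary flow `e^{itA}`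
    (∀ (A : Observable H) (t : ℝ), unitaryFlow A t ∈ unitary (H →L[ℂ] H)) ∧
    (∀ (A : Observable H) (ψ : H) (t : ℝ), HasDerivAt (fun s => unitaryFlow A s ψ)
      (schrodingerVector ħ A (unitaryFlow A t ψ)) t) ∧
    (∀ (A : Observable H) (ψ : H), ψ ≠ 0 →
      IsMIntegralCurve (I := 𝓘(ℝ, EuclideanSpace ℂ (Fin n)))
        (fun t => ray (unitaryFlow A t ψ)) (fun x => schrodingerAnchor n ħ x A)) ∧
    -- measurement: stationary states are eigenstates, and the Born probabilities
    (∀ (A : Observable H) (ψ : H), ψ ≠ 0 →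
      (schrodingerAnchor n ħ (ray ψ) A = 0 ↔ ∃ a : ℝ, (A : H →L[ℂ] H) ψ = (a : ℂ) • ψ)) ∧
    (∀ (A : Observable H) (b : OrthonormalBasis (Fin (n + 1)) ℂ H) (a : Fin (n + 1) → ℝ),
      (∀ k, (A : H →L[ℂ] H) (b k) = (a k : ℂ) • b k) → ∀ ψ : H, ‖ψ‖ = 1 →
        ∑ k, ‖⟪b k, ψ⟫_ℂ‖ ^ 2 = 1 ∧
        expectation A (ray ψ) = ∑ k, a k * ‖⟪b k, ψ⟫_ℂ‖ ^ 2) ∧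
    -- the structure is a Lie algebroid, with a uniquely determined bracket
    ∃! bracket : ObservableSection n H → ObservableSection n H → ObservableSection n H,
      (∀ A B : Observable H, bracket (hamiltonianSection n A) (hamiltonianSection n B) =
        hamiltonianSection n (observableBracket A B)) ∧
      IsLieAlgebroid (𝓘(ℝ, EuclideanSpace ℂ (Fin n))) (Observable H)
        (ObservableBundle H) bracket (schrodingerAnchor n ħ) := by
  have hħ0 : ħ ≠ 0 := hħ.ne'
  refine ⟨isPrincipalBundle_phaseProj, isKahlerMetric_fubiniStudy,
    fun ψ h => ⟨rayDeriv_surjective h, fubiniStudy_rayDeriv h⟩,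
    fun U => ⟨fun ψ h => unitaryAct_ray U h, contMDiff_unitaryAct n U,
      fubiniStudy_mfderiv_unitaryAct U⟩,
    fun A ψ h => ?_, schrodingerAnchor_hamiltonian hħ0, unitaryFlow_mem_unitary,
    fun A ψ t => ?_, fun A ψ h => isMIntegralCurve_ray_unitaryFlow hħ0 A h,
    fun A ψ h => schrodingerAnchor_eq_zero_iff hħ0 A h,
    fun A b a hb ψ h => ⟨?_, expectation_ray_eq_sum A b a hb h⟩,
    sectionBracket, ⟨sectionBracket_hamiltonianSection, isLieAlgebroid_sectionBracket hħ0⟩, ?_⟩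
  · rw [schrodingerVector_eq_I_smul hħ0]
    exact schrodingerAnchor_ray hħ0 A h
  · rw [schrodingerVector_eq_I_smul hħ0]
    exact hasDerivAt_unitaryFlow A ψ t
  · rw [b.sum_sq_norm_inner_right, h, one_pow]
  · rintro β ⟨hσ, hβ⟩
    exact hβ.bracket_ext (isLieAlgebroid_sectionBracket hħ0) fun A A' =>
      (hσ A A').trans (sectionBracket_hamiltonianSection A A').symm
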